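/- Let $M\in\mathbb N$, let $A\in\mathbb R^{M\times M}$ be diagonal, $W\in\mathbb R^{M\times M}$, $h\in\mathbb R^M$, $t_0\in\mathbb R$, $\Delta t>0$. For a set $\Omega^k\subseteq\{1,\dots,M\}$ let $D_{\Omega^k}$ be the diagonal matrix with entry $1$ at the indices in $\Omega^k$ and $0$ elsewhere, and put $W_{\Omega^k}=A+WD_{\Omega^k}$ (the matrix of the ReLU network $Z\mapsto AZ+W\max(Z,0)+h$ on the sub-region where exactly the coordinates in $\Omega^k$ are positive). Suppose that $W_{\Omega^k}$ is invertible, possibly not diagonalizable, and that its characteristic polynomial vanishes at $1$. Write $\log W_{\Omega^k}$ for any complex matrix $L$ with $e^L=W_{\Omega^k}$ none of whose eigenvalues is a nonzero integer multiple of $2\pi i$. (1) Such a logarithm exists; it can be chosen with all eigenvalues in the strip $|\operatorname{Im}\mu|\le\pi$. If, moreover, for every $k\ge1$ and every real $\mu<0$ the $k\times k$ Jordan block with eigenvalue $\mu$ occurs an even number of times in the Jordan form of $W_{\Omega^k}$, then it can be chosen so that in addition $\tilde W=\frac1{\Delta t}\log W_{\Omega^k}$ is a real matrix. (2) For every such logarithm,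 $\tilde W=\frac1{\Delta t}\log W_{\Omega^k}$ is not invertible, the matrix $W_{\Omega^k}\int_0^{\Delta t}e^{-\frac{\tau}{\Delta t}\log W_{\Omega^k}}\,d\tau$ is invertible, and with $$\tilde h=\Big(W_{\Omega^k}\int_0^{\Delta t}e^{-\frac{\tau}{\Delta t}\log W_{\Omega^k}}\,d\tau\Big)^{-1}h$$ the system $\dot\zeta=\tilde W\zeta+\tilde h$ is equivalent on $[t_0,t_0+\Delta t]$ to the discrete-time system $Z\mapsto W_{\Omega^k}Z+h$ with time step $\Delta t$: for every $Z_{t_0}\in\mathbb R^M$ there is a solution $\zeta:[t_0,t_0+\Delta t]\to\mathbb C^M$ with $\zeta(t_0)=Z_{t_0}$, and every such solution satisfies $\zeta(t_0+\Delta t)=W_{\Omega^k}Z_{t_0}+h$. -/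

import Mathlib

open scoped Matrix

noncomputable section

namespace PLRNN

/-- The transition matrix `A + W D_Ω` of the piecewise linear recurrent network
`Z ↦ A Z + W max(Z, 0) + h` on the sub-region in which exactly the coordinates in `Ω` are positive.
Here `A = diag a`, and `D_Ω` is the diagonal 0/1 matrix with support `Ω`; the `2 ^ M` finsets `Ω`
index the `2 ^ M` sub-regions. -/
def transitionMatrix {M : ℕ} (a : Fin M → ℝ) (W : Matrix (Fin M) (Fin M) ℝ)
    (Ω : Finset (Fin M)) : Matrix (Fin M) (Fin M) ℝ :=
  Matrix.diagonal a + W * Matrix.diagonal (fun i => if i ∈ Ω then 1 else 0)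

/-- A real matrix viewed as a complex one. -/
def toComplex {M : ℕ} (B : Matrix (Fin M) (Fin M) ℝ) : Matrix (Fin M) (Fin M) ℂ :=
  B.map (fun x : ℝ => (x : ℂ))

/-- A real vector viewed as a complex one. -/
def vecToComplex {M : ℕ} (v : Fin M → ℝ) : Fin M → ℂ := fun i => (v i : ℂ)

/-- `L` is a logarithm of `B` no eigenvalue of which is a nonzero integer multiple of `2πi`. -/
def IsLog {M : ℕ} (B L : Matrix (Fin M) (Fin M) ℂ) : Prop :=
  NormedSpace.exp L = B ∧
    ∀ μ ∈ spectrum ℂ L, ∀ k : ℤ, k ≠ 0 → μ ≠ 2 * Real.pi * Complex.I * (k : ℂ)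

/-- The (entrywise) integral `∫₀^Δ exp (-(τ / Δ) L) dτ`. -/
def expIntegral {M : ℕ} (L : Matrix (Fin M) (Fin M) ℂ) (Δ : ℝ) : Matrix (Fin M) (Fin M) ℂ :=
  Matrix.of fun i j => ∫ τ in (0 : ℝ)..Δ, NormedSpace.exp (-((τ / Δ : ℝ) : ℂ) • L) i j

/-- `ζ` solves `ζ' = V ζ + b` on the set `s` of times. -/
def IsSolutionOn {M : ℕ} (V : Matrix (Fin M) (Fin M) ℂ) (b : Fin M → ℂ) (s : Set ℝ)
    (ζ : ℝ → Fin M → ℂ) : Prop :=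
  ∀ t ∈ s, HasDerivWithinAt ζ (V *ᵥ ζ t + b) s t

/-- The system `ζ' = V ζ + b` is equivalent on `[t₀, t₀ + Δ]` to the map `Z ↦ B Z + h`:
from every state `Z₀ ∈ ℝ^M` at time `t₀` there is a solution, and every such solution is at
`B Z₀ + h` at time `t₀ + Δ`. -/
def IsEquivalentSystem {M : ℕ} (B : Matrix (Fin M) (Fin M) ℝ) (h : Fin M → ℝ) (t₀ Δ : ℝ)
    (V : Matrix (Fin M) (Fin M) ℂ) (b : Fin M → ℂ) : Prop :=
  ∀ Z₀ : Fin M → ℝ,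
    (∃ ζ : ℝ → Fin M → ℂ,
      IsSolutionOn V b (Set.Icc t₀ (t₀ + Δ)) ζ ∧ ζ t₀ = vecToComplex Z₀) ∧
    ∀ ζ : ℝ → Fin M → ℂ,
      IsSolutionOn V b (Set.Icc t₀ (t₀ + Δ)) ζ → ζ t₀ = vecToComplex Z₀ →
        ζ (t₀ + Δ) = vecToComplex (B *ᵥ Z₀ + h)

/-- The `k × k` Jordan block with eigenvalue `μ`. -/
def jordanBlock (k : ℕ) (μ : ℂ) : Matrix (Fin k) (Fin k) ℂ :=
  Matrix.of fun i j => if i = j then μ else if i.val + 1 = j.val then 1 else 0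

/-- The block-diagonal matrix of the Jordan blocks of (positive) sizes `size i` and eigenvalues
`ev i`, for `i = 0, …, r - 1`, is a Jordan form of `B`. -/
def IsJordanForm {M r : ℕ} (B : Matrix (Fin M) (Fin M) ℂ) (size : Fin r → ℕ) (ev : Fin r → ℂ) :
    Prop :=
  (∀ i, 0 < size i) ∧
    ∃ (e : (Σ i, Fin (size i)) ≃ Fin M) (P : Matrix (Fin M) (Fin M) ℂ), IsUnit P ∧
      B = P * Matrix.reindex e e
        (Matrix.blockDiagonal' fun i => jordanBlock (size i) (ev i)) * P⁻¹

/-- In the Jordan form of `B`, for every `k` and every negative real `μ` the `k × k` Jordan block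
with eigenvalue `μ` occurs an even number of times. -/
def EvenNegativeJordanBlocks {M : ℕ} (B : Matrix (Fin M) (Fin M) ℂ) : Prop :=
  ∃ (r : ℕ) (size : Fin r → ℕ) (ev : Fin r → ℂ), IsJordanForm B size ev ∧
    ∀ (k : ℕ) (μ : ℝ), μ < 0 → Even (Nat.card {i : Fin r // size i = k ∧ ev i = (μ : ℂ)})

end PLRNN

end

/-! Write `B` for the transition matrix. The obstruction to a principal logarithm is the spectrum on
the negative real axis. A real polynomial `e` gives the spectral projector `E = e(B)` onto that
part, and `X = B(1 - 2E)`, with those eigenvalues reflected, has spectrum in the slit plane. So `X`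
has a real logarithm, `logIntegral X`. It remains to find a logarithm of `1 - 2E`: if `K` commutes
with `B`, `KE = K` and `K² = -E`, then `exp (πK) = 1 - 2E`, hence `exp (logIntegral X + πK) = X(1 -
2E) = B` (`exp_logIntegral_add`). The choice `K = iE` always works. When negative Jordan blocks come
in equal pairs, a signed swap of partners is a real `K` (`exists_real_complexStructure`).

For the second half, an eigenvalue `μ` of `L` gives `S = expIntegral L Δ` the eigenvalue `Δ(1 -
exp(-μ))/μ`, or `Δ` if `μ = 0`. It vanishes only at nonzero multiples of `2πi`, which are excluded,
so `S` is invertible (`isUnit_expIntegral`). Variation of constants then gives the endpoint `BZ +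
BSb`, and `b = (BS)⁻¹h` makes it `BZ + h`. Since `1` is an eigenvalue of `B`, `L` must have
eigenvalue `0` (`not_isUnit_of_exp_eq`).

Diagonalizability is never needed: a nonzero subspace invariant under a matrix contains an
eigenvector of it, which reduces invertibility and spectral bounds to scalars. -/

noncomputable section

namespace PLRNN

/-! ### Exponentials and an integral logarithm in a real Banach algebra. -/

section NormedAlgebraExponential

open Set NormedSpace

section NormedAlgebra

variable {𝔸 : Type*} [NormedRing 𝔸] [NormedAlgebra ℝ 𝔸] [CompleteSpace 𝔸]

/-- The exponential of a differentiable curve of commuting elements. -/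
theorem hasDerivAt_exp_of_commute {F : ℝ → 𝔸} {f' : 𝔸} {t : ℝ} (hF : HasDerivAt F f' t)
    (hc : ∀ s, Commute (F s) (F t)) :
    HasDerivAt (fun s => exp (F s)) (exp (F t) * f') t := by
  let _ : NormedAlgebra ℚ 𝔸 := NormedAlgebra.restrictScalars ℚ ℝ 𝔸
  have h1 : HasDerivAt (fun s => F s - F t) f' t := hF.sub_const _
  have h2 : HasDerivAt (fun s => exp (F s - F t)) f' t := by
    have h0 : HasFDerivAt (exp : 𝔸 → 𝔸) (1 : 𝔸 →L[ℝ] 𝔸) (F t - F t) := by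
      rw [sub_self]; exact hasFDerivAt_exp_zero
    exact h0.comp_hasDerivAt t h1
  -- Commutation reduces the claim to the derivative of `exp` at `0`, which is the identity.
  have h3 : (fun s => exp (F s)) = fun s => exp (F t) * exp (F s - F t) := by
    funext s
    rw [← exp_add_of_commute]
    · congr 1; abel
    · exact ((hc s).symm.sub_right (Commute.refl _))
  rw [h3]
  exact h2.const_mul _

/-- A solution of `G' = F' G` with values commuting suitably is `exp F`. -/
theorem exp_eq_of_hasDerivAt {F f G : ℝ → 𝔸} {T : ℝ} (hT : 0 ≤ T)
    (hF : ∀ t, HasDerivAt F (f t) t) (hc : ∀ s t, Commute (F s) (F t))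
    (hG : ∀ t ∈ Icc 0 T, HasDerivAt G (f t * G t) t) (hF0 : F 0 = 0) (hG0 : G 0 = 1) :
    exp (F T) = G T := by
  let _ : NormedAlgebra ℚ 𝔸 := NormedAlgebra.restrictScalars ℚ ℝ 𝔸
  have hd : ∀ t ∈ Icc 0 T, HasDerivAt (fun t => exp (-F t) * G t) 0 t := by
    intro t ht
    have := (hasDerivAt_exp_of_commute (hF t).fun_neg
      (fun s => ((hc s t).neg_left).neg_right)).fun_mul (hG t ht)
    convert this using 1
    noncomm_ring
  have := constant_of_has_deriv_right_zero (f := fun t => exp (-F t) * G t) (a := 0) (b := T)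
    (fun t ht => (hd t ht).continuousAt.continuousWithinAt)
    (fun t ht => (hd t (Ico_subset_Icc_self ht)).hasDerivWithinAt) T (right_mem_Icc.2 hT)
  simp only [hF0, hG0, neg_zero, exp_zero, mul_one] at this
  calc exp (F T) = exp (F T) * (exp (-F T) * G T) := by rw [this, mul_one]
    _ = G T := by
      rw [← mul_assoc, ← exp_add_of_commute ((Commute.refl _).neg_right), add_neg_cancel,
        exp_zero, one_mul]

/-- If `K² = -E` for an idempotent `E` acting as the identity on `K`, then `exp (πK) = 1 - 2E`. -/
theorem exp_pi_smul {E K : 𝔸} (hKE : K * E = K) (hKK : K * K = -E) :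
    exp (Real.pi • K) = 1 - 2 * E := by
  -- Euler's formula: `K` is an imaginary unit relative to `E`, so `exp (tK)` is a rotation there
  -- and trivial on `1 - E`.
  have key := exp_eq_of_hasDerivAt (F := fun t : ℝ => t • K) (f := fun _ => K)
    (G := fun t => 1 - E + Real.cos t • E + Real.sin t • K) Real.pi_pos.le
    (fun t => by simpa using (hasDerivAt_id' t).smul_const K)
    (fun s t => ((Commute.refl K).smul_left s).smul_right t)
    (fun t _ => by
      have := (((Real.hasDerivAt_cos t).smul_const E).const_add (1 - E)).fun_add
        ((Real.hasDerivAt_sin t).smul_const K)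
      refine this.congr_deriv ?_
      simp only [mul_add, mul_sub, mul_one, mul_smul_comm, hKE, hKK, sub_self, zero_add]
      module)
    (by simp) (by simp)
  rw [key]
  simp only [Real.cos_pi, Real.sin_pi, zero_smul, add_zero, neg_smul, one_smul]
  noncomm_ring

/-- The principal logarithm `∫₀¹ (X - 1) (1 + t (X - 1))⁻¹ dt`. -/
def logIntegral (X : 𝔸) : 𝔸 :=
  ∫ t in (0 : ℝ)..1, (X - 1) * Ring.inverse (1 + t • (X - 1))

theorem continuousOn_logIntegrand {X : 𝔸}
    (hX : ∀ t ∈ Icc (0 : ℝ) 1, IsUnit (1 + t • (X - 1))) :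
    ContinuousOn (fun t : ℝ => (X - 1) * Ring.inverse (1 + t • (X - 1))) (Icc 0 1) := by
  intro t ht
  obtain ⟨u, hu⟩ := hX t ht
  have h1 : ContinuousAt Ring.inverse (1 + t • (X - 1)) := by
    rw [← hu]; exact NormedRing.inverse_continuousAt u
  have h2 : ContinuousAt (fun t : ℝ => 1 + t • (X - 1)) t := by fun_prop
  exact (continuousAt_const.mul (ContinuousAt.comp (f := fun t : ℝ => 1 + t • (X - 1)) h1 h2)).continuousWithinAt

theorem commute_intervalIntegral {Y : 𝔸} {f : ℝ → 𝔸} {a b : ℝ}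
    (hf : IntervalIntegrable f MeasureTheory.volume a b)
    (hY : ∀ t ∈ uIcc a b, Commute Y (f t)) : Commute Y (∫ t in a..b, f t) := by
  have h1 := (ContinuousLinearMap.mul ℝ 𝔸 Y).intervalIntegral_comp_comm hf
  have h2 := ((ContinuousLinearMap.mul ℝ 𝔸).flip Y).intervalIntegral_comp_comm hf
  simp only [ContinuousLinearMap.mul_apply', ContinuousLinearMap.flip_apply] at h1 h2
  rw [Commute, SemiconjBy, ← h1, ← h2]
  exact intervalIntegral.integral_congr fun t ht => hY t ht

omit [CompleteSpace 𝔸] in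
theorem commute_logIntegrand {X Y : 𝔸} (hXY : Commute Y X) {t : ℝ}
    (ht : IsUnit (1 + t • (X - 1))) :
    Commute Y ((X - 1) * Ring.inverse (1 + t • (X - 1))) := by
  have h1 : Commute Y (X - 1) := hXY.sub_right (Commute.one_right Y)
  refine h1.mul_right ?_
  have h2 : Commute Y (1 + t • (X - 1)) := (Commute.one_right Y).add_right (h1.smul_right t)
  obtain ⟨u, hu⟩ := ht
  rw [← hu] at h2 ⊢
  rw [Ring.inverse_unit]
  exact h2.units_inv_right

theorem intervalIntegrable_logIntegrand {X : 𝔸}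
    (hX : ∀ t ∈ Icc (0 : ℝ) 1, IsUnit (1 + t • (X - 1))) :
    IntervalIntegrable (fun t : ℝ => (X - 1) * Ring.inverse (1 + t • (X - 1)))
      MeasureTheory.volume 0 1 :=
  ContinuousOn.intervalIntegrable (by
    rw [uIcc_of_le zero_le_one]; exact continuousOn_logIntegrand hX)

theorem commute_logIntegral {X Y : 𝔸} (hX : ∀ t ∈ Icc (0 : ℝ) 1, IsUnit (1 + t • (X - 1)))
    (hXY : Commute Y X) : Commute Y (logIntegral X) :=
  commute_intervalIntegral (intervalIntegrable_logIntegrand hX) fun t ht =>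
    commute_logIntegrand hXY (hX t (by rwa [uIcc_of_le zero_le_one] at ht))

theorem map_logIntegral {F : Type*} [NormedAddCommGroup F] [NormedSpace ℝ F] [CompleteSpace F]
    [FiniteDimensional ℝ 𝔸] {X : 𝔸} (hX : ∀ t ∈ Icc (0 : ℝ) 1, IsUnit (1 + t • (X - 1)))
    (T : 𝔸 →ₗ[ℝ] F) :
    T (logIntegral X) = ∫ t in (0 : ℝ)..1, T ((X - 1) * Ring.inverse (1 + t • (X - 1))) :=
  (T.toContinuousLinearMap.intervalIntegral_comp_comm (intervalIntegrable_logIntegrand hX)).symm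

/-- The integrand is the logarithmic derivative of the segment `1 + t(X - 1)` from `1` to `X`. -/
theorem exp_logIntegral {X : 𝔸} (hX : ∀ t ∈ Icc (0 : ℝ) 1, IsUnit (1 + t • (X - 1))) :
    exp (logIntegral X) = X := by
  set g : ℝ → 𝔸 := fun t => (X - 1) * Ring.inverse (1 + t • (X - 1)) with hg
  -- Constant extension beyond `[0, 1]` makes the integrand continuous on all of `ℝ`, so its
  -- primitive is differentiable everywhere.
  set f : ℝ → 𝔸 := fun t => g (projIcc 0 1 zero_le_one t) with hf
  have hproj : ∀ t ∈ Icc (0 : ℝ) 1, f t = g t := fun t ht => by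
    simp only [hf]; rw [projIcc_of_mem zero_le_one ht]
  have hfc : Continuous f := (continuousOn_logIntegrand hX).comp_continuous
    (continuous_subtype_val.comp continuous_projIcc) (fun t => Subtype.prop _)
  have hff : ∀ s t, Commute (f s) (f t) := fun s t => by
    refine commute_logIntegrand (Commute.symm ?_) (hX _ (Subtype.prop _))
    exact commute_logIntegrand (Commute.refl X) (hX _ (Subtype.prop _))
  have hint : ∀ a b, IntervalIntegrable f MeasureTheory.volume a b :=
    fun a b => hfc.intervalIntegrable a b
  have h1 : logIntegral X = ∫ t in (0 : ℝ)..1, f t := by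
    refine intervalIntegral.integral_congr fun t ht => ?_
    rw [uIcc_of_le zero_le_one] at ht
    exact (hproj t ht).symm
  rw [h1]
  have key := exp_eq_of_hasDerivAt (F := fun t => ∫ s in (0 : ℝ)..t, f s) (f := f)
    (G := fun t => 1 + t • (X - 1)) zero_le_one
    (fun t => intervalIntegral.integral_hasDerivAt_right (hint 0 t)
      (hfc.stronglyMeasurableAtFilter _ _) hfc.continuousAt)
    (fun s t => commute_intervalIntegral (hint 0 t) fun t' _ =>
      (commute_intervalIntegral (hint 0 s) fun s' _ => hff t' s').symm)
    (fun t ht => by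
      have : HasDerivAt (fun t : ℝ => 1 + t • (X - 1)) (X - 1) t := by
        simpa using ((hasDerivAt_id' t).smul_const (X - 1)).const_add 1
      convert this using 1
      rw [hproj t ht, hg]
      simp only
      rw [mul_assoc, Ring.inverse_mul_cancel _ (hX t ht), mul_one])
    (by simp) (by simp)
  rw [key]
  simp

end NormedAlgebra

end NormedAlgebraExponential

/-! ### Matrix exponentials, the integral `expIntegral`, and affine linear systems. -/

section MatrixExponential

open Set NormedSpace

attribute [local instance] Matrix.linftyOpNormedRing Matrix.linftyOpNormedAlgebra

variable {n : Type*} [Fintype n] [DecidableEq n]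

/-- An invariant nonzero subspace contains an eigenvector. -/
theorem exists_eigenvector_mem (W : Submodule ℂ (n → ℂ)) (hW : ∃ v ∈ W, v ≠ 0)
    (A : Matrix n n ℂ) (hA : ∀ v ∈ W, A *ᵥ v ∈ W) :
    ∃ v ∈ W, v ≠ 0 ∧ ∃ μ : ℂ, A *ᵥ v = μ • v := by
  obtain ⟨v, hv, hv0⟩ := hW
  have : Nontrivial W := ⟨⟨v, hv⟩, 0, fun h => hv0 (congrArg Subtype.val h)⟩
  obtain ⟨μ, hμ⟩ := Module.End.exists_eigenvalue
    ((Matrix.toLin' A).restrict (p := W) (q := W) (fun w hw => by simpa using hA w hw))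
  obtain ⟨w, hw⟩ := hμ.exists_hasEigenvector
  refine ⟨w, w.2, fun h => hw.2 (Subtype.ext h), μ, ?_⟩
  simpa using congrArg Subtype.val hw.apply_eq_smul

/-- Application of a complex matrix to a fixed vector. -/
def mulVecCLM (v : n → ℂ) : Matrix n n ℂ →L[ℝ] (n → ℂ) :=
  LinearMap.toContinuousLinearMap
    { toFun := fun X => X *ᵥ v
      map_add' := fun X Y => Matrix.add_mulVec X Y v
      map_smul' := fun c X => Matrix.smul_mulVec c X v }

omit [DecidableEq n] in
@[simp] theorem mulVecCLM_apply (v : n → ℂ) (X : Matrix n n ℂ) : mulVecCLM v X = X *ᵥ v := rfl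

/-- An entry of a complex matrix. -/
def entryCLM (i j : n) : Matrix n n ℂ →L[ℝ] ℂ :=
  LinearMap.toContinuousLinearMap
    { toFun := fun X => X i j
      map_add' := fun _ _ => rfl
      map_smul' := fun _ _ => rfl }

theorem exp_mulVec_eigenvector {X : Matrix n n ℂ} {v : n → ℂ} {μ : ℂ} (hv : X *ᵥ v = μ • v) :
    exp X *ᵥ v = Complex.exp μ • v := by
  have hp : ∀ k : ℕ, X ^ k *ᵥ v = μ ^ k • v := by
    intro k
    induction k with
    | zero => simp
    | succ k ih => rw [pow_succ, ← Matrix.mulVec_mulVec, hv, Matrix.mulVec_smul, ih, smul_smul,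
        pow_succ, mul_comm]
  have h1 := (exp_series_hasSum_exp' (𝕂 := ℝ) X).mapL (mulVecCLM v)
  have h2 := (exp_series_hasSum_exp' (𝕂 := ℝ) μ).smul_const v
  simp only [mulVecCLM_apply, Matrix.smul_mulVec, hp] at h1
  rw [Complex.exp_eq_exp_ℂ]
  refine h1.unique ?_
  simpa only [smul_assoc] using h2

theorem HasDerivWithinAt.mulVec {U : ℝ → Matrix n n ℂ} {ζ : ℝ → n → ℂ} {U' : Matrix n n ℂ}
    {ζ' : n → ℂ} {s : Set ℝ} {t : ℝ} (hU : HasDerivWithinAt U U' s t)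
    (hζ : HasDerivWithinAt ζ ζ' s t) :
    HasDerivWithinAt (fun t => U t *ᵥ ζ t) (U' *ᵥ ζ t + U t *ᵥ ζ') s t := by
  rw [hasDerivWithinAt_pi] at hζ ⊢
  intro i
  simp only [Matrix.mulVec, dotProduct, Pi.add_apply, ← Finset.sum_add_distrib]
  refine HasDerivWithinAt.fun_sum fun j _ => ?_
  exact ((entryCLM i j).hasFDerivAt.comp_hasDerivWithinAt t hU).mul (hζ j)

theorem hasDerivAt_exp_smul (V : Matrix n n ℂ) (t₀ t : ℝ) :
    HasDerivAt (fun t : ℝ => exp ((t - t₀) • V)) (exp ((t - t₀) • V) * V) t := by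
  have h := hasDerivAt_exp_smul_const (𝕂 := ℝ) V (t - t₀)
  have h1 := h.scomp t ((hasDerivAt_id' t).sub_const t₀)
  rw [one_smul] at h1
  exact h1

theorem continuous_exp_smul (V : Matrix n n ℂ) (t₀ : ℝ) :
    Continuous (fun t : ℝ => exp ((t - t₀) • V)) :=
  continuous_iff_continuousAt.2 fun t => (hasDerivAt_exp_smul V t₀ t).continuousAt

theorem commute_exp_of_commute {A V : Matrix n n ℂ} (h : Commute A V) : Commute A (exp V) := by
  let _ : NormedAlgebra ℚ (Matrix n n ℂ) := NormedAlgebra.restrictScalars ℚ ℝ _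
  exact h.exp_right

section expIntegral
variable {M : ℕ}

/-- The form `τ - 0` matches the curves `exp ((t - t₀) • V)` with `t₀ = 0`. -/
theorem neg_div_smul_eq (L : Matrix (Fin M) (Fin M) ℂ) (Δ τ : ℝ) :
    (-((τ / Δ : ℝ) : ℂ)) • L = (τ - 0) • -(((1 / Δ : ℝ) : ℂ) • L) := by
  ext i j
  simp
  ring

theorem expIntegral_mulVec_apply (L : Matrix (Fin M) (Fin M) ℂ) (Δ : ℝ) (v : Fin M → ℂ) :
    expIntegral L Δ *ᵥ v =
      ∫ τ in (0 : ℝ)..Δ, exp ((τ - 0) • -(((1 / Δ : ℝ) : ℂ) • L)) *ᵥ v := by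
  have hc : ∀ i j, Continuous fun τ : ℝ => exp ((τ - 0) • -(((1 / Δ : ℝ) : ℂ) • L)) i j :=
    fun i j => (entryCLM i j).continuous.comp (continuous_exp_smul _ 0)
  have hcv : Continuous fun τ : ℝ => exp ((τ - 0) • -(((1 / Δ : ℝ) : ℂ) • L)) *ᵥ v :=
    (mulVecCLM v).continuous.comp (continuous_exp_smul _ 0)
  ext i
  have h := (ContinuousLinearMap.proj (R := ℝ) (φ := fun _ : Fin M => ℂ) i).intervalIntegral_comp_comm
    (hcv.intervalIntegrable (μ := MeasureTheory.volume) 0 Δ)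
  simp only [ContinuousLinearMap.proj_apply] at h
  rw [← h]
  simp only [Matrix.mulVec, dotProduct]
  have hint : ∀ j ∈ Finset.univ, IntervalIntegrable
      (fun τ : ℝ => exp ((τ - 0) • -(((1 / Δ : ℝ) : ℂ) • L)) i j * v j) MeasureTheory.volume 0 Δ :=
    fun j _ => ((hc i j).mul continuous_const).intervalIntegrable _ _
  rw [intervalIntegral.integral_finsetSum hint]
  refine Finset.sum_congr rfl fun j _ => ?_
  rw [intervalIntegral.integral_mul_const]
  simp only [expIntegral, Matrix.of_apply, neg_div_smul_eq]

/-- Multiplying the scalar integral `Δ(1 - exp(-μ))/μ` through by `μ` keeps the identity true at `μ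
= 0`. -/
theorem expIntegral_mulVec_eigenvector {L : Matrix (Fin M) (Fin M) ℂ} {Δ : ℝ} (hΔ : Δ ≠ 0)
    {v : Fin M → ℂ} {μ : ℂ} (hv : L *ᵥ v = μ • v) :
    μ • (expIntegral L Δ *ᵥ v) = ((Δ : ℂ) * (1 - Complex.exp (-μ))) • v := by
  rw [expIntegral_mulVec_apply]
  have h1 : ∀ τ : ℝ, exp ((τ - 0) • -(((1 / Δ : ℝ) : ℂ) • L)) *ᵥ v =
      Complex.exp ((-μ / Δ) * τ) • v := fun τ => by
    apply exp_mulVec_eigenvector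
    rw [← neg_div_smul_eq, Matrix.smul_mulVec, hv, smul_smul]
    congr 1
    push_cast
    ring
  have hΔ' : (Δ : ℂ) ≠ 0 := by exact_mod_cast hΔ
  simp only [h1]
  rw [intervalIntegral.integral_smul_const, smul_smul]
  congr 1
  by_cases hμ : μ = 0
  · simp [hμ]
  · rw [integral_exp_mul_complex (by simp [hμ, hΔ])]
    have : -μ / (Δ : ℂ) * Δ = -μ := by field_simp
    rw [this]
    simp
    field_simp
    ring

theorem expIntegral_commute_mulVec (L : Matrix (Fin M) (Fin M) ℂ) (Δ : ℝ) (v : Fin M → ℂ) :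
    expIntegral L Δ *ᵥ (L *ᵥ v) = L *ᵥ (expIntegral L Δ *ᵥ v) := by
  rw [expIntegral_mulVec_apply, expIntegral_mulVec_apply]
  have hcont : Continuous fun τ : ℝ => exp ((τ - 0) • -(((1 / Δ : ℝ) : ℂ) • L)) *ᵥ v :=
    (mulVecCLM v).continuous.comp (continuous_exp_smul _ 0)
  have := ((Matrix.mulVecLin L).restrictScalars ℝ).toContinuousLinearMap.intervalIntegral_comp_comm
    (hcont.intervalIntegrable (μ := MeasureTheory.volume) 0 Δ)
  simp only [LinearMap.coe_toContinuousLinearMap', LinearMap.coe_restrictScalars,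
    Matrix.mulVecLin_apply] at this
  rw [← this]
  congr 1
  funext τ
  rw [Matrix.mulVec_mulVec, Matrix.mulVec_mulVec]
  congr 1
  have : Commute L ((τ - 0) • -(((1 / Δ : ℝ) : ℂ) • L)) :=
    ((Commute.refl L).smul_right _).neg_right.smul_right _
  exact (commute_exp_of_commute this).symm.eq

theorem isUnit_of_mulVec_ne_zero {A : Matrix n n ℂ} (hA : ∀ v, A *ᵥ v = 0 → v = 0) : IsUnit A := by
  rw [Matrix.isUnit_iff_isUnit_det, isUnit_iff_ne_zero]
  intro h
  obtain ⟨v, hv, h0⟩ := Matrix.exists_mulVec_eq_zero_iff.2 h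
  exact hv (hA v h0)

theorem mem_spectrum_of_mulVec {A : Matrix n n ℂ} {v : n → ℂ} {μ : ℂ} (hv0 : v ≠ 0)
    (hv : A *ᵥ v = μ • v) : μ ∈ spectrum ℂ A := by
  rw [← Matrix.spectrum_toLin']
  refine Module.End.HasEigenvalue.mem_spectrum
    (Module.End.hasEigenvalue_of_hasEigenvector (x := v) ⟨?_, hv0⟩)
  rw [Module.End.mem_eigenspace_iff]
  simpa using hv

/-- The kernel is `L`-invariant, so if nonzero it contains an eigenvector of `L`. Its eigenvalue is
not `0`, where the integral acts as `Δ`, and otherwise satisfies `exp(-μ) = 1`. -/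
theorem isUnit_expIntegral {L : Matrix (Fin M) (Fin M) ℂ} {Δ : ℝ} (hΔ : Δ ≠ 0)
    (hL : ∀ μ ∈ spectrum ℂ L, ∀ k : ℤ, k ≠ 0 → μ ≠ 2 * Real.pi * Complex.I * (k : ℂ)) :
    IsUnit (expIntegral L Δ) := by
  refine isUnit_of_mulVec_ne_zero fun v hv => ?_
  by_contra hv0
  obtain ⟨w, hw, hw0, μ, hμ⟩ := exists_eigenvector_mem
    (LinearMap.ker (Matrix.mulVecLin (expIntegral L Δ))) ⟨v, by simpa using hv, hv0⟩ L
    (fun u hu => by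
      simp only [LinearMap.mem_ker, Matrix.mulVecLin_apply] at hu ⊢
      rw [expIntegral_commute_mulVec, hu, Matrix.mulVec_zero])
  simp only [LinearMap.mem_ker, Matrix.mulVecLin_apply] at hw
  have hΔ' : (Δ : ℂ) ≠ 0 := by exact_mod_cast hΔ
  by_cases hμ0 : μ = 0
  · have h1 := expIntegral_mulVec_apply L Δ w
    have h2 : ∀ τ : ℝ, exp ((τ - 0) • -(((1 / Δ : ℝ) : ℂ) • L)) *ᵥ w = w := fun τ => by
      have := exp_mulVec_eigenvector (X := (τ - 0) • -(((1 / Δ : ℝ) : ℂ) • L)) (v := w) (μ := 0)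
        (by rw [← neg_div_smul_eq, Matrix.smul_mulVec, hμ, hμ0]; simp)
      simpa using this
    rw [hw, intervalIntegral.integral_congr (g := fun _ => w) fun τ _ => h2 τ,
      intervalIntegral.integral_const, sub_zero] at h1
    exact (smul_ne_zero hΔ hw0) h1.symm
  · have h := expIntegral_mulVec_eigenvector hΔ hμ
    rw [hw, smul_zero, eq_comm, smul_eq_zero, mul_eq_zero] at h
    have h1 : Complex.exp (-μ) = 1 := by
      rcases h with (h | h) | h
      · exact absurd h hΔ'
      · exact (sub_eq_zero.1 h).symm
      · exact absurd h hw0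
    obtain ⟨k, hk⟩ := Complex.exp_eq_one_iff.1 h1
    refine hL μ (mem_spectrum_of_mulVec hw0 hμ) (-k) ?_ ?_
    · rintro hk0
      apply hμ0
      rw [neg_eq_zero] at hk0
      simpa [hk0] using hk
    · rw [← neg_neg μ, hk]
      push_cast
      ring

/-- Every solution of an affine system satisfies the variation of constants formula. -/
theorem IsSolutionOn.exp_neg_mulVec {V : Matrix (Fin M) (Fin M) ℂ} {b : Fin M → ℂ} {t₀ Δ : ℝ}
    (hΔ : 0 ≤ Δ) {ζ : ℝ → Fin M → ℂ} (hζ : IsSolutionOn V b (Icc t₀ (t₀ + Δ)) ζ) :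
    exp (Δ • -V) *ᵥ ζ (t₀ + Δ) = ζ t₀ + ∫ τ in (0 : ℝ)..Δ, exp ((τ - 0) • -V) *ᵥ b := by
  -- The integrating factor cancels the term `V ζ`.
  have hd : ∀ t ∈ Icc t₀ (t₀ + Δ), HasDerivWithinAt (fun t => exp ((t - t₀) • -V) *ᵥ ζ t)
      (exp ((t - t₀) • -V) *ᵥ b) (Icc t₀ (t₀ + Δ)) t := fun t ht => by
    refine (HasDerivWithinAt.mulVec (hasDerivAt_exp_smul (-V) t₀ t).hasDerivWithinAt
      (hζ t ht)).congr_deriv ?_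
    rw [← Matrix.mulVec_mulVec, Matrix.neg_mulVec, Matrix.mulVec_neg, Matrix.mulVec_add]
    abel
  have hc : Continuous fun t => exp ((t - t₀) • -V) *ᵥ b :=
    (mulVecCLM b).continuous.comp (continuous_exp_smul _ t₀)
  have h := intervalIntegral.integral_eq_sub_of_hasDerivAt_of_le (by linarith)
    (fun t ht => (hd t ht).continuousWithinAt)
    (fun t ht => (hd t (Ioo_subset_Icc_self ht)).hasDerivAt (Icc_mem_nhds ht.1 ht.2))
    (hc.intervalIntegrable t₀ (t₀ + Δ))
  have h2 := intervalIntegral.integral_comp_sub_right (a := t₀) (b := t₀ + Δ)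
    (fun t => exp (t • -V) *ᵥ b) t₀
  simp only [sub_self, add_sub_cancel_left] at h2
  rw [h2] at h
  simp only [sub_self, add_sub_cancel_left, zero_smul, exp_zero, Matrix.one_mulVec] at h
  simp only [sub_zero]
  rw [h]
  abel

theorem exists_isSolutionOn (V : Matrix (Fin M) (Fin M) ℂ) (b Z : Fin M → ℂ) (t₀ : ℝ)
    (s : Set ℝ) : ∃ ζ : ℝ → Fin M → ℂ, IsSolutionOn V b s ζ ∧ ζ t₀ = Z := by
  refine ⟨fun t => exp ((t - t₀) • V) *ᵥ (Z + ∫ τ in t₀..t, exp ((τ - t₀) • -V) *ᵥ b),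
    fun t _ => ?_, by simp⟩
  have hc : Continuous fun t => exp ((t - t₀) • -V) *ᵥ b :=
    (mulVecCLM b).continuous.comp (continuous_exp_smul _ t₀)
  have h1 : HasDerivAt (fun t => Z + ∫ τ in t₀..t, exp ((τ - t₀) • -V) *ᵥ b)
      (exp ((t - t₀) • -V) *ᵥ b) t :=
    (intervalIntegral.integral_hasDerivAt_right (hc.intervalIntegrable _ _)
      (hc.stronglyMeasurableAtFilter _ _) hc.continuousAt).const_add Z
  refine (HasDerivWithinAt.mulVec (hasDerivAt_exp_smul V t₀ t).hasDerivWithinAt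
    h1.hasDerivWithinAt).congr_deriv ?_
  have h2 : exp ((t - t₀) • V) * exp ((t - t₀) • -V) = 1 := by
    rw [← Matrix.exp_add_of_commute _ _ (((Commute.refl V).neg_right.smul_left _).smul_right _)]
    simp
  have h3 : Commute (exp ((t - t₀) • V)) V := ((Commute.refl V).smul_left _).exp_left
  rw [h3.eq, Matrix.mulVec_mulVec (M := exp ((t - t₀) • V)), h2, Matrix.one_mulVec,
    Matrix.mulVec_mulVec]

theorem isEquivalentSystem_of_exp_eq {B : Matrix (Fin M) (Fin M) ℝ} {h : Fin M → ℝ} {t₀ Δ : ℝ}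
    (hΔ : 0 < Δ) {L : Matrix (Fin M) (Fin M) ℂ} (hL : exp L = toComplex B)
    (hS : IsUnit (toComplex B * expIntegral L Δ)) :
    IsEquivalentSystem B h t₀ Δ (((1 / Δ : ℝ) : ℂ) • L)
      ((toComplex B * expIntegral L Δ)⁻¹ *ᵥ vecToComplex h) := by
  intro Z
  refine ⟨exists_isSolutionOn _ _ _ _ _, fun ζ hζ h0 => ?_⟩
  have h1 := hζ.exp_neg_mulVec hΔ.le
  rw [h0, ← expIntegral_mulVec_apply] at h1
  have h2 : Δ • -(((1 / Δ : ℝ) : ℂ) • L) = -L := by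
    have hΔ' : (Δ : ℂ) ≠ 0 := by exact_mod_cast hΔ.ne'
    ext i j
    simp
    field_simp
  rw [h2] at h1
  have h3 : toComplex B * exp (-L) = 1 := by
    rw [← hL, ← Matrix.exp_add_of_commute _ _ (Commute.refl L).neg_right, add_neg_cancel, exp_zero]
  -- `h1` reads `exp(-L) ζ(t₀ + Δ) = Z + S b`, and multiplication by `B = exp L` isolates the
  -- endpoint.
  have h4 := congrArg (toComplex B *ᵥ ·) h1
  simp only [Matrix.mulVec_mulVec, h3, Matrix.one_mulVec, Matrix.mulVec_add] at h4
  rw [← mul_assoc, Matrix.mul_nonsing_inv _ ((Matrix.isUnit_iff_isUnit_det _).1 hS),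
    Matrix.one_mulVec] at h4
  rw [h4]
  ext i
  simp [vecToComplex, toComplex, Matrix.mulVec, dotProduct]

end expIntegral

end MatrixExponential

/-! ### The spectral projector on the negative axis and the logarithm built from it. -/

section RealLogarithm

open Set NormedSpace Polynomial

attribute [local instance] Matrix.linftyOpNormedRing Matrix.linftyOpNormedAlgebra

/-- A complex number that is a negative real. -/
def IsNegReal (z : ℂ) : Prop := z.re < 0 ∧ z.im = 0

/-- Negative roots are split off with full multiplicity, which makes the two factors coprime. -/
theorem exists_factor_isNegReal (d : ℕ) : ∀ f : ℝ[X], f ≠ 0 → f.natDegree = d → ∃ p q : ℝ[X],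
    f = p * q ∧ (∀ z : ℂ, aeval z p = 0 → IsNegReal z) ∧
      ∀ z : ℂ, aeval z q = 0 → ¬ IsNegReal z := by
  induction d with
  | zero =>
    intro f hf hd
    refine ⟨1, f, (one_mul f).symm, by simp, fun z hz => ?_⟩
    rw [Polynomial.eq_C_of_natDegree_eq_zero hd] at hz hf
    simp at hz hf
    exact absurd hz hf
  | succ d ih =>
    intro f hf hd
    by_cases h : ∃ x : ℝ, x < 0 ∧ f.IsRoot x
    · obtain ⟨x, hx, hroot⟩ := h
      obtain ⟨g, hg⟩ := dvd_iff_isRoot.2 hroot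
      have hg0 : g ≠ 0 := by rintro rfl; exact hf (by simpa using hg)
      have hgd : g.natDegree = d := by
        have := natDegree_mul (X_sub_C_ne_zero x) hg0
        rw [← hg, natDegree_X_sub_C, hd] at this
        omega
      obtain ⟨p, q, hpq, hp, hq⟩ := ih g hg0 hgd
      refine ⟨(X - C x) * p, q, by rw [hg, hpq, mul_assoc], fun z hz => ?_, hq⟩
      rw [map_mul, mul_eq_zero] at hz
      rcases hz with hz | hz
      · have : z = (x : ℂ) := by simpa [sub_eq_zero] using hz
        rw [this]
        exact ⟨by simpa using hx, by simp⟩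
      · exact hp z hz
    · refine ⟨1, f, (one_mul f).symm, by simp, fun z hz hneg => h ⟨z.re, hneg.1, ?_⟩⟩
      have hz' : z = algebraMap ℝ ℂ z.re := Complex.ext (by simp) (by simp [hneg.2])
      rw [hz', aeval_algebraMap_apply] at hz
      simpa using hz

/-- There is a real polynomial acting as the projector onto the part of the spectrum on the
negative real axis. -/
theorem exists_projector_polynomial (f : ℝ[X]) (hf : f ≠ 0) : ∃ e : ℝ[X],
    f ∣ e * (1 - e) ∧ ∀ z : ℂ, aeval z f = 0 →
      (IsNegReal z → aeval z e = 1) ∧ (¬ IsNegReal z → aeval z e = 0) := by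
  obtain ⟨p, q, hpq, hp, hq⟩ := exists_factor_isNegReal _ f hf rfl
  have hcop : IsCoprime p q := by
    rw [isCoprime_iff_aeval_ne_zero_of_isAlgClosed ℝ ℂ]
    intro z
    by_contra! h
    exact hq z h.2 (hp z h.1)
  obtain ⟨u, v, huv⟩ := hcop
  have h1 : 1 - v * q = u * p := by rw [← huv]; ring
  -- By Bézout, `v q` is `0` modulo `q` and `1` modulo `p`.
  refine ⟨v * q, ⟨v * u, by rw [h1, hpq]; ring⟩, fun z hz => ?_⟩
  rw [hpq, map_mul, mul_eq_zero] at hz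
  constructor
  · intro hneg
    have hpz : aeval z p = 0 := hz.resolve_right fun h => hq z h hneg
    have := congrArg (aeval z) h1
    simp only [map_sub, map_one, map_mul, hpz, mul_zero] at this ⊢
    exact (sub_eq_zero.1 this).symm
  · intro hneg
    have hqz : aeval z q = 0 := hz.resolve_left fun h => hneg (hp z h)
    simp [hqz]

theorem aeval_mulVec_eigenvector {n : Type*} [Fintype n] [DecidableEq n] {A : Matrix n n ℂ}
    {v : n → ℂ} {μ : ℂ} (hv : A *ᵥ v = μ • v) (p : ℝ[X]) :
    aeval A p *ᵥ v = aeval μ p • v := by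
  induction p using Polynomial.induction_on' with
  | add p q hp hq => rw [map_add, Matrix.add_mulVec, hp, hq, map_add, add_smul]
  | monomial k a =>
    have hk : A ^ k *ᵥ v = μ ^ k • v := by
      induction k with
      | zero => simp
      | succ k ih => rw [pow_succ, ← Matrix.mulVec_mulVec, hv, Matrix.mulVec_smul, ih, smul_smul,
          pow_succ, mul_comm]
    rw [aeval_monomial, aeval_monomial, ← Algebra.smul_def, ← Algebra.smul_def,
      Matrix.smul_mulVec, hk, smul_assoc]

theorem semiconjBy_aeval {A : Type*} [Ring A] [Algebra ℝ A] {a x y : A} (h : SemiconjBy a x y)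
    (p : ℝ[X]) : SemiconjBy a (aeval x p) (aeval y p) := by
  induction p using Polynomial.induction_on' with
  | add p q hp hq => rw [map_add, map_add]; exact hp.add_right hq
  | monomial k c =>
    rw [aeval_monomial, aeval_monomial]
    exact (show SemiconjBy a _ _ from Algebra.commute_algebraMap_right c a).mul_right
      (h.pow_right k)

theorem commute_aeval {A : Type*} [Ring A] [Algebra ℝ A] {x y : A} (h : Commute x y) (p : ℝ[X]) :
    Commute x (aeval y p) :=
  semiconjBy_aeval h p

variable {M : ℕ}

/-- `toComplex` as an algebra homomorphism. -/
def toComplexHom (M : ℕ) : Matrix (Fin M) (Fin M) ℝ →ₐ[ℝ] Matrix (Fin M) (Fin M) ℂ :=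
  Complex.ofRealAm.mapMatrix

theorem toComplex_eq (B : Matrix (Fin M) (Fin M) ℝ) : toComplex B = toComplexHom M B := rfl

theorem toComplex_exp (B : Matrix (Fin M) (Fin M) ℝ) : toComplex (exp B) = exp (toComplex B) := by
  have hcont : Continuous (toComplexHom M) :=
    (toComplexHom M).toLinearMap.continuous_of_finiteDimensional
  exact map_exp (toComplexHom M) hcont B

theorem isUnit_of_isUnit_toComplex {A : Matrix (Fin M) (Fin M) ℝ} (h : IsUnit (toComplex A)) :
    IsUnit A := by
  rw [Matrix.isUnit_iff_isUnit_det, isUnit_iff_ne_zero] at h ⊢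
  intro h0
  apply h
  have := (Complex.ofRealHom.map_det A).symm
  rw [h0, map_zero] at this
  exact this

theorem aeval_toComplex (B : Matrix (Fin M) (Fin M) ℝ) (p : ℝ[X]) :
    aeval (toComplex B) p = toComplex (aeval B p) := by
  rw [toComplex_eq, toComplex_eq, aeval_algHom_apply]

theorem aeval_charpoly_of_mulVec {B : Matrix (Fin M) (Fin M) ℝ} {v : Fin M → ℂ} {z : ℂ}
    (hv0 : v ≠ 0) (hv : toComplex B *ᵥ v = z • v) : aeval z B.charpoly = 0 := by
  have h := aeval_mulVec_eigenvector hv B.charpoly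
  rw [aeval_toComplex, Matrix.aeval_self_charpoly] at h
  have h0 : toComplex (0 : Matrix (Fin M) (Fin M) ℝ) = 0 := by rw [toComplex_eq, map_zero]
  rw [h0, Matrix.zero_mulVec, eq_comm, smul_eq_zero] at h
  exact h.resolve_right hv0

/-- The slit plane is star-shaped about `1`. -/
theorem one_add_smul_mem_slitPlane {z : ℂ} (hz : z ∈ Complex.slitPlane) {t : ℝ}
    (ht : t ∈ Icc (0 : ℝ) 1) : 1 + (t : ℂ) * (z - 1) ∈ Complex.slitPlane := by
  obtain ⟨h0, h1⟩ := ht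
  rw [Complex.mem_slitPlane_iff] at hz ⊢
  simp only [Complex.add_re, Complex.one_re, Complex.mul_re, Complex.ofReal_re, Complex.sub_re,
    Complex.ofReal_im, zero_mul, sub_zero, Complex.add_im, Complex.one_im, Complex.mul_im,
    Complex.sub_im, add_zero, zero_add]
  rcases h0.eq_or_lt with rfl | h0
  · left; simp
  rcases hz with hz | hz
  · left; nlinarith [mul_pos h0 hz]
  · right; exact mul_ne_zero h0.ne' hz

section Logarithm

variable {B : Matrix (Fin M) (Fin M) ℝ} {e : ℝ[X]}

/-- The matrix with the part of the spectrum on the negative real axis reflected. -/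
def reflect (B : Matrix (Fin M) (Fin M) ℝ) (e : ℝ[X]) : Matrix (Fin M) (Fin M) ℝ :=
  B * (1 - 2 * aeval B e)

/-- The eigenvalue of the reflected matrix. -/
def reflectEigenvalue (z : ℂ) (e : ℝ[X]) : ℂ := z * (1 - 2 * aeval z e)

theorem reflect_mulVec {v : Fin M → ℂ} {z : ℂ} (hv : toComplex B *ᵥ v = z • v) :
    toComplex (reflect B e) *ᵥ v = reflectEigenvalue z e • v := by
  have h1 := aeval_mulVec_eigenvector hv e
  rw [aeval_toComplex] at h1
  have h2 : toComplex (reflect B e) =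
      toComplex B * (1 - (toComplex (aeval B e) + toComplex (aeval B e))) := by
    simp only [reflect, toComplex_eq, map_mul, map_sub, map_one, two_mul, map_add]
  rw [h2, ← Matrix.mulVec_mulVec, Matrix.sub_mulVec, Matrix.one_mulVec, Matrix.add_mulVec, h1,
    Matrix.mulVec_sub, Matrix.mulVec_add, Matrix.mulVec_smul, hv, reflectEigenvalue]
  module

/-- Negative eigenvalues change sign and the others stay; `0` is excluded by invertibility. -/
theorem reflectEigenvalue_mem_slitPlane (hB : IsUnit B)
    (he : ∀ z : ℂ, aeval z B.charpoly = 0 →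
      (IsNegReal z → aeval z e = 1) ∧ (¬ IsNegReal z → aeval z e = 0))
    {v : Fin M → ℂ} {z : ℂ} (hv0 : v ≠ 0) (hv : toComplex B *ᵥ v = z • v) :
    reflectEigenvalue z e ∈ Complex.slitPlane := by
  obtain ⟨h1, h2⟩ := he z (aeval_charpoly_of_mulVec hv0 hv)
  by_cases hz : IsNegReal z
  · rw [reflectEigenvalue, h1 hz, Complex.mem_slitPlane_iff]
    left
    norm_num
    exact hz.1
  · rw [reflectEigenvalue, h2 hz, mul_zero, sub_zero, mul_one, Complex.mem_slitPlane_iff]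
    by_contra! h
    refine hz ⟨lt_of_le_of_ne h.1 fun h0 => ?_, h.2⟩
    have hz0 : z = 0 := Complex.ext h0 h.2
    rw [hz0, zero_smul] at hv
    apply hv0
    have hU : IsUnit (toComplex B) := hB.map (toComplexHom M)
    have := congrArg ((toComplex B)⁻¹ *ᵥ ·) hv
    simpa [Matrix.nonsing_inv_mul _ ((Matrix.isUnit_iff_isUnit_det _).1 hU)] using this

theorem toComplex_segment_mulVec {A : Matrix (Fin M) (Fin M) ℝ} {v : Fin M → ℂ} {z : ℂ}
    (hv : toComplex A *ᵥ v = z • v) (t : ℝ) :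
    toComplex (1 + t • (A - 1)) *ᵥ v = (1 + (t : ℂ) * (z - 1)) • v := by
  have h : toComplex (1 + t • (A - 1)) = 1 + t • (toComplex A - 1) := by
    simp only [toComplex_eq, map_add, map_one, map_smul, map_sub]
  rw [h, Matrix.add_mulVec, Matrix.one_mulVec, Matrix.smul_mulVec, Matrix.sub_mulVec, hv,
    Matrix.one_mulVec, ← Complex.coe_smul]
  module

theorem commute_reflect : Commute B (reflect B e) :=
  (Commute.refl B).mul_right ((Commute.one_right B).sub_right
    ((Nat.cast_commute 2 B).symm.mul_right (commute_aeval (Commute.refl B) e)))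

theorem isUnit_segment_reflect (hB : IsUnit B)
    (he : ∀ z : ℂ, aeval z B.charpoly = 0 →
      (IsNegReal z → aeval z e = 1) ∧ (¬ IsNegReal z → aeval z e = 0)) :
    ∀ t ∈ Icc (0 : ℝ) 1, IsUnit (1 + t • (reflect B e - 1)) := by
  intro t ht
  refine isUnit_of_isUnit_toComplex (isUnit_of_mulVec_ne_zero fun v hv => ?_)
  by_contra hv0
  have hcomm : Commute (toComplex B) (toComplex (1 + t • (reflect B e - 1))) :=
    Commute.map ((Commute.one_right B).add_right
      ((commute_reflect.sub_right (Commute.one_right B)).smul_right t)) (toComplexHom M)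
  obtain ⟨w, hw, hw0, z, hz⟩ := exists_eigenvector_mem
    (LinearMap.ker (Matrix.mulVecLin (toComplex (1 + t • (reflect B e - 1)))))
    ⟨v, by simpa using hv, hv0⟩ (toComplex B) (fun u hu => by
      simp only [LinearMap.mem_ker, Matrix.mulVecLin_apply] at hu ⊢
      rw [Matrix.mulVec_mulVec, ← hcomm.eq, ← Matrix.mulVec_mulVec, hu, Matrix.mulVec_zero])
  simp only [LinearMap.mem_ker, Matrix.mulVecLin_apply] at hw
  rw [toComplex_segment_mulVec (reflect_mulVec hz), smul_eq_zero] at hw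
  exact Complex.slitPlane_ne_zero (one_add_smul_mem_slitPlane
    (reflectEigenvalue_mem_slitPlane hB he hw0 hz) ht) (hw.resolve_right hw0)

theorem toComplex_logIntegral_mulVec {X : Matrix (Fin M) (Fin M) ℝ}
    (hX : ∀ t ∈ Icc (0 : ℝ) 1, IsUnit (1 + t • (X - 1)))
    {v : Fin M → ℂ} {z : ℂ} (hz : z ∈ Complex.slitPlane) (hv : toComplex X *ᵥ v = z • v) :
    toComplex (logIntegral X) *ᵥ v = Complex.log z • v := by
  have h := map_logIntegral hX
    ((mulVecCLM v).toLinearMap ∘ₗ (toComplexHom M).toLinearMap)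
  have h1 : toComplex (logIntegral X) *ᵥ v = ∫ t in (0 : ℝ)..1,
      toComplex ((X - 1) * Ring.inverse (1 + t • (X - 1))) *ᵥ v := h
  have h2 : ∀ t ∈ uIcc (0 : ℝ) 1, toComplex ((X - 1) * Ring.inverse (1 + t • (X - 1))) *ᵥ v =
      (1 + t • (z - 1))⁻¹ • (z - 1) • v := by
    intro t ht
    rw [uIcc_of_le zero_le_one] at ht
    have h3 : toComplex ((X - 1) * Ring.inverse (1 + t • (X - 1))) =
        (toComplex X - 1) * toComplex (Ring.inverse (1 + t • (X - 1))) := by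
      simp only [toComplex_eq, map_mul, map_sub, map_one]
    have h4 : toComplex (Ring.inverse (1 + t • (X - 1))) * toComplex (1 + t • (X - 1)) = 1 := by
      simp only [toComplex_eq, ← map_mul]
      rw [Ring.inverse_mul_cancel _ (hX t ht), map_one]
    have h5 : toComplex (Ring.inverse (1 + t • (X - 1))) *ᵥ v = (1 + (t : ℂ) * (z - 1))⁻¹ • v := by
      have h6 := congrArg (· *ᵥ v) h4
      simp only [← Matrix.mulVec_mulVec, toComplex_segment_mulVec hv, Matrix.one_mulVec,
        Matrix.mulVec_smul] at h6
      rw [← h6, smul_smul, inv_mul_cancel₀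
        (Complex.slitPlane_ne_zero (one_add_smul_mem_slitPlane hz ht)), one_smul, h6]
    rw [h3, ← Matrix.mulVec_mulVec, h5, Matrix.mulVec_smul, Matrix.sub_mulVec, hv,
      Matrix.one_mulVec, Complex.real_smul]
    module
  rw [h1, intervalIntegral.integral_congr h2, intervalIntegral.integral_smul_const, smul_smul]
  have hlog := Complex.log_eq_integral (z := z - 1) (by simpa using hz)
  rw [add_sub_cancel] at hlog
  rw [hlog, mul_comm]

/-- `K` may be non-real, so the real-linear commutator with `K` is passed under the integral of the
real integrand. -/
theorem commute_toComplex_logIntegral {X : Matrix (Fin M) (Fin M) ℝ}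
    (hX : ∀ t ∈ Icc (0 : ℝ) 1, IsUnit (1 + t • (X - 1))) {K : Matrix (Fin M) (Fin M) ℂ}
    (hK : Commute K (toComplex X)) : Commute K (toComplex (logIntegral X)) := by
  have h := map_logIntegral hX
    ((LinearMap.mulLeft ℝ K - LinearMap.mulRight ℝ K) ∘ₗ (toComplexHom M).toLinearMap)
  have h1 : K * toComplex (logIntegral X) - toComplex (logIntegral X) * K = ∫ t in (0 : ℝ)..1,
      (K * toComplex ((X - 1) * Ring.inverse (1 + t • (X - 1))) -
        toComplex ((X - 1) * Ring.inverse (1 + t • (X - 1))) * K) := h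
  rw [intervalIntegral.integral_congr (g := fun _ => 0) (fun t ht => ?_),
    intervalIntegral.integral_zero] at h1
  · exact sub_eq_zero.1 h1
  · rw [uIcc_of_le zero_le_one] at ht
    have h3 : toComplex ((X - 1) * Ring.inverse (1 + t • (X - 1))) =
        (toComplex X - 1) * Ring.inverse (1 + t • (toComplex X - 1)) := by
      have h4 : toComplex (1 + t • (X - 1)) = 1 + t • (toComplex X - 1) := by
        simp only [toComplex_eq, map_add, map_one, map_smul, map_sub]
      rw [← h4]
      obtain ⟨u, hu⟩ := hX t ht
      rw [← hu, Ring.inverse_unit]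
      have h5 : toComplex (u : Matrix (Fin M) (Fin M) ℝ) =
        (Units.map (toComplexHom M : _ →* Matrix (Fin M) (Fin M) ℂ) u :
          (Matrix (Fin M) (Fin M) ℂ)ˣ) := rfl
      rw [h5, Ring.inverse_unit, ← map_inv]
      simp [toComplex_eq]
    have h6 : IsUnit (1 + t • (toComplex X - 1)) := by
      have := (hX t ht).map (toComplexHom M)
      simpa only [map_add, map_smul, map_sub, map_one, ← toComplex_eq] using this
    simp only [h3]
    exact sub_eq_zero.2 (commute_logIntegrand hK h6).eq

theorem aeval_mul_self_of_charpoly_dvd (hdvd : B.charpoly ∣ e * (1 - e)) :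
    aeval B e * aeval B e = aeval B e := by
  obtain ⟨g, hg⟩ := hdvd
  have h := congrArg (aeval B) hg
  rw [map_mul, map_mul, Matrix.aeval_self_charpoly, zero_mul, map_sub, map_one, mul_sub, mul_one,
    sub_eq_zero] at h
  exact h.symm

theorem exp_logIntegral_add {K : Matrix (Fin M) (Fin M) ℂ} (hB : IsUnit B)
    (hdvd : B.charpoly ∣ e * (1 - e))
    (he : ∀ z : ℂ, aeval z B.charpoly = 0 →
      (IsNegReal z → aeval z e = 1) ∧ (¬ IsNegReal z → aeval z e = 0))
    (hKB : Commute K (toComplex B)) (hKE : K * toComplex (aeval B e) = K)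
    (hKK : K * K = -toComplex (aeval B e)) :
    exp (toComplex (logIntegral (reflect B e)) + Real.pi • K) = toComplex B ∧
      ∀ μ ∈ spectrum ℂ (toComplex (logIntegral (reflect B e)) + Real.pi • K),
        |μ.im| ≤ Real.pi := by
  set E := aeval B e with hE
  have hX := isUnit_segment_reflect hB he
  have hEE : E * E = E := aeval_mul_self_of_charpoly_dvd hdvd
  have hKEc : Commute K (toComplex E) := by
    rw [hE, ← aeval_toComplex]
    exact commute_aeval hKB e
  have hrefl : toComplex (reflect B e) = toComplex B * (1 - 2 * toComplex E) := by
    simp only [reflect, toComplex_eq, map_mul, map_sub, map_one, map_ofNat, ← hE]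
  have hKX : Commute K (toComplex (reflect B e)) := by
    rw [hrefl]
    exact hKB.mul_right ((Commute.one_right K).sub_right ((Nat.cast_commute 2 K).symm.mul_right hKEc))
  have hKL := commute_toComplex_logIntegral hX hKX
  have hBL : Commute (toComplex B) (toComplex (logIntegral (reflect B e))) :=
    (commute_logIntegral hX commute_reflect).map (toComplexHom M)
  refine ⟨?_, fun μ hμ => ?_⟩
  · have h3 : exp (logIntegral (reflect B e)) = reflect B e := exp_logIntegral hX
    have h4 : exp (Real.pi • K) = 1 - 2 * toComplex E := exp_pi_smul hKE hKK
    rw [Matrix.exp_add_of_commute _ _ (hKL.symm.smul_right _), ← toComplex_exp, h3, h4, hrefl,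
      mul_assoc]
    have h1 : toComplex E * toComplex E = toComplex E := by
      rw [toComplex_eq, ← map_mul, hEE]
    have h2 : (1 - 2 * toComplex E) * (1 - 2 * toComplex E) = 1 := by
      calc _ = 1 - 4 * toComplex E + 4 * (toComplex E * toComplex E) := by noncomm_ring
        _ = 1 := by rw [h1]; abel
    rw [h2, mul_one]
  · rw [← Matrix.spectrum_toLin'] at hμ
    obtain ⟨v, hv⟩ := (Module.End.hasEigenvalue_iff_mem_spectrum.2 hμ).exists_hasEigenvector
    set L := toComplex (logIntegral (reflect B e)) + Real.pi • K with hL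
    have hv1 : L *ᵥ v = μ • v := by simpa using hv.apply_eq_smul
    have hcK : Commute K L := hKL.add_right ((Commute.refl K).smul_right _)
    have hcB : Commute (toComplex B) L := hBL.add_right (hKB.symm.smul_right _)
    -- Since `L`, `K` and `B` commute, the `μ`-eigenspace of `L` contains a common eigenvector `w`.
    -- On it `μ = log(±z) + πκ` with `κ² = -e(z)`: either `κ = ±i` and the logarithm is real, or `κ
    -- = 0` and the bound is that of the argument.
    obtain ⟨x, hx, hx0, κ, hκ⟩ := exists_eigenvector_mem
      (LinearMap.ker (Matrix.mulVecLin L - μ • LinearMap.id)) ⟨v, by simp [hv1], hv.2⟩ K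
      (fun u hu => by
        simp only [LinearMap.mem_ker, LinearMap.sub_apply, Matrix.mulVecLin_apply,
          LinearMap.smul_apply, LinearMap.id_apply, sub_eq_zero] at hu ⊢
        rw [Matrix.mulVec_mulVec, ← hcK.eq, ← Matrix.mulVec_mulVec, hu, Matrix.mulVec_smul])
    obtain ⟨w, hw, hw0, z, hz⟩ := exists_eigenvector_mem
      (LinearMap.ker (Matrix.mulVecLin L - μ • LinearMap.id) ⊓
        LinearMap.ker (Matrix.mulVecLin K - κ • LinearMap.id))
      ⟨x, ⟨hx, by simp [hκ]⟩, hx0⟩ (toComplex B)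
      (fun u hu => by
        simp only [Submodule.mem_inf, LinearMap.mem_ker, LinearMap.sub_apply,
          Matrix.mulVecLin_apply, LinearMap.smul_apply, LinearMap.id_apply, sub_eq_zero] at hu ⊢
        rw [Matrix.mulVec_mulVec, ← hcB.eq, ← Matrix.mulVec_mulVec, hu.1, Matrix.mulVec_smul,
          Matrix.mulVec_mulVec, hKB.eq, ← Matrix.mulVec_mulVec, hu.2, Matrix.mulVec_smul]
        exact ⟨rfl, rfl⟩)
    simp only [Submodule.mem_inf, LinearMap.mem_ker, LinearMap.sub_apply,
      Matrix.mulVecLin_apply, LinearMap.smul_apply, LinearMap.id_apply, sub_eq_zero] at hw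
    obtain ⟨hLw, hKw⟩ := hw
    have hslit := reflectEigenvalue_mem_slitPlane hB he hw0 hz
    have hlog := toComplex_logIntegral_mulVec hX hslit (reflect_mulVec hz)
    have hμ' : μ = Complex.log (reflectEigenvalue z e) + Real.pi * κ := by
      rw [hL, Matrix.add_mulVec, hlog, Matrix.smul_mulVec, hKw, ← Complex.coe_smul, smul_smul,
        ← add_smul] at hLw
      exact (smul_left_injective ℂ hw0 hLw).symm
    have hκE : κ * κ = -aeval z e := by
      have h1 := congrArg (· *ᵥ w) hKK
      simp only [← Matrix.mulVec_mulVec, hKw, Matrix.mulVec_smul, Matrix.neg_mulVec, hE,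
        ← aeval_toComplex, aeval_mulVec_eigenvector hz, smul_smul, ← neg_smul] at h1
      exact smul_left_injective ℂ hw0 h1
    obtain ⟨h1, h2⟩ := he z (aeval_charpoly_of_mulVec hw0 hz)
    by_cases hneg : IsNegReal z
    · rw [h1 hneg] at hκE
      have hre : 0 < -z.re := neg_pos.2 hneg.1
      have hlogim : (Complex.log (reflectEigenvalue z e)).im = 0 := by
        have : reflectEigenvalue z e = ((-z.re : ℝ) : ℂ) := by
          rw [reflectEigenvalue, h1 hneg]
          apply Complex.ext
          · norm_num
          · norm_num [hneg.2]
        rw [this, ← Complex.ofReal_log hre.le, Complex.ofReal_im]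
      have hκim : |κ.im| = 1 := by
        have h3 : κ = Complex.I ∨ κ = -Complex.I :=
          mul_self_eq_mul_self_iff.1 (by rw [hκE, Complex.I_mul_I])
        rcases h3 with h3 | h3 <;> simp [h3]
      rw [hμ', Complex.add_im, hlogim, Complex.im_ofReal_mul, zero_add, abs_mul, hκim]
      simp [abs_of_pos Real.pi_pos]
    · rw [h2 hneg, neg_zero, mul_self_eq_zero] at hκE
      rw [hμ', hκE, mul_zero, add_zero]
      rw [Complex.log_im]
      exact Complex.abs_arg_le_pi _

end Logarithm

end RealLogarithm

/-! ### A real complex structure from paired Jordan blocks. -/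

section JordanPairing

open Set Polynomial

section Pairing

theorem exists_pairing_of_even {T : Type*} [Fintype T] (h : Even (Nat.card T)) :
    ∃ (σ : T → T) (s : T → ℝ), (∀ t, σ (σ t) = t) ∧ (∀ t, s (σ t) = -s t) ∧
      ∀ t, s t * s t = 1 := by
  obtain ⟨m, hm⟩ := h
  have hcard : Fintype.card T = Fintype.card (Fin m × Bool) := by
    rw [← Nat.card_eq_fintype_card, hm]
    simp
    ring
  let f := Fintype.equivOfCardEq hcard
  refine ⟨fun t => f.symm ((f t).1, !(f t).2), fun t => if (f t).2 then 1 else -1, ?_, ?_, ?_⟩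
  · intro t; simp
  · intro t
    cases h : (f t).2 <;> simp [h]
  · intro t
    cases h : (f t).2 <;> simp [h]

/-- Here `c` will record size and eigenvalue of a block; zero signs switch off the blocks that are
not negative. -/
theorem exists_fiberwise_pairing {ι Y : Type*} [Fintype ι] (c : ι → Y) (p : Y → Prop)
    (h : ∀ y, p y → Even (Nat.card {i // c i = y})) :
    ∃ (σ : ι → ι) (s : ι → ℝ), (∀ i, σ (σ i) = i) ∧ (∀ i, c (σ i) = c i) ∧
      (∀ i, s (σ i) = -s i) ∧ (∀ i, p (c i) → s i * s i = 1) ∧ ∀ i, ¬ p (c i) → s i = 0 := by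
  classical
  have h1 : ∀ y, ∃ (σ : {i // c i = y} → {i // c i = y}) (s : {i // c i = y} → ℝ),
      (∀ t, σ (σ t) = t) ∧ (∀ t, s (σ t) = -s t) ∧ (p y → ∀ t, s t * s t = 1) ∧
        (¬ p y → ∀ t, s t = 0) := by
    intro y
    by_cases hy : p y
    · obtain ⟨σ, s, h1, h2, h3⟩ := exists_pairing_of_even (h y hy)
      exact ⟨σ, s, h1, h2, fun _ => h3, fun h => absurd hy h⟩
    · exact ⟨id, 0, by simp, by simp, fun h => absurd h hy, by simp⟩
  choose σ s h1 h2 h3 h4 using h1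
  have hσ : ∀ i y (hi : c i = y), (σ y ⟨i, hi⟩).1 = (σ (c i) ⟨i, rfl⟩).1 := by
    rintro i y rfl; rfl
  have hs : ∀ i y (hi : c i = y), s y ⟨i, hi⟩ = s (c i) ⟨i, rfl⟩ := by
    rintro i y rfl; rfl
  refine ⟨fun i => (σ (c i) ⟨i, rfl⟩).1, fun i => s (c i) ⟨i, rfl⟩, fun i => ?_,
    fun i => (σ (c i) ⟨i, rfl⟩).2, fun i => ?_, fun i hi => h3 _ hi _, fun i hi => h4 _ hi _⟩
  · simp only
    rw [← hσ _ (c i) (σ (c i) ⟨i, rfl⟩).2, Subtype.coe_eta, h1]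
  · simp only
    rw [← hs _ (c i) (σ (c i) ⟨i, rfl⟩).2, Subtype.coe_eta, h2]

end Pairing

section SignedPermutation

variable {S : Type*} [Fintype S] [DecidableEq S]

/-- The matrix of an involution with signs. -/
def signedInvolution (τ : S → S) (s : S → ℝ) : Matrix S S ℝ :=
  Matrix.of fun x y => if τ x = y then s x else 0

theorem signedInvolution_mul (τ : S → S) (s : S → ℝ) (N : Matrix S S ℝ) (x y : S) :
    (signedInvolution τ s * N) x y = s x * N (τ x) y := by
  simp [signedInvolution, Matrix.mul_apply]

theorem mul_signedInvolution {τ : S → S} (hτ : ∀ x, τ (τ x) = x) (s : S → ℝ) (N : Matrix S S ℝ)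
    (x y : S) : (N * signedInvolution τ s) x y = s (τ y) * N x (τ y) := by
  have : ∀ z, τ z = y ↔ τ y = z := fun z => ⟨fun h => by rw [← h, hτ], fun h => by rw [← h, hτ]⟩
  simp [signedInvolution, Matrix.mul_apply, this, mul_comm]

/-- On a swapped pair with signs `±1` this is the rotation by a right angle. -/
theorem signedInvolution_mul_self {τ : S → S} (hτ : ∀ x, τ (τ x) = x) {s : S → ℝ}
    (hs : ∀ x, s (τ x) = -s x) :
    signedInvolution τ s * signedInvolution τ s = -Matrix.diagonal fun x => s x * s x := by
  ext x y
  rw [signedInvolution_mul]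
  by_cases h : x = y
  · subst h; simp [signedInvolution, hτ, hs]
  · simp [signedInvolution, hτ, h]

end SignedPermutation

section RealSimilarity

/-- Real matrices that are simultaneously similar over `ℂ` are simultaneously similar over `ℝ`. -/
theorem exists_real_similarity {n : Type*} [Fintype n] [DecidableEq n] (P : Matrix n n ℂ)
    (hP : IsUnit P) : ∃ R : Matrix n n ℝ, IsUnit R ∧ ∀ A C : Matrix n n ℝ,
      A.map Complex.ofReal * P = P * C.map Complex.ofReal → A * R = R * C := by
  set X := P.map Complex.re
  set Y := P.map Complex.im
  -- The polynomial `det (X + tY)` is nonzero at `t = i`, where it equals `det P`, hence at some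
  -- real `t`. Real and imaginary parts of `AP = PC` show that `X + tY` intertwines `A` and `C`.
  let Q : Matrix n n ℝ[X] := X.map Polynomial.C + (Polynomial.X : ℝ[X]) • Y.map Polynomial.C
  have hQ : ∀ {A : Type} [CommRing A] [Algebra ℝ A] (z : A), aeval z Q.det =
      (X.map (algebraMap ℝ A) + z • Y.map (algebraMap ℝ A)).det := by
    intro A _ _ z
    rw [AlgHom.map_det]
    congr 1
    ext i j
    simp [Q]
    exact mul_comm _ _
  have hdet : Q.det ≠ 0 := by
    intro h
    have h1 := hQ Complex.I
    have h2 : X.map (algebraMap ℝ ℂ) + Complex.I • Y.map (algebraMap ℝ ℂ) = P := by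
      ext i j
      simp only [Matrix.add_apply, Matrix.map_apply, Matrix.smul_apply, X, Y, smul_eq_mul,
        Complex.coe_algebraMap]
      rw [mul_comm]
      exact Complex.re_add_im _
    rw [h2, h, map_zero] at h1
    exact ((Matrix.isUnit_iff_isUnit_det _).1 hP).ne_zero h1.symm
  obtain ⟨t, ht⟩ : ∃ t : ℝ, Q.det.eval t ≠ 0 := by
    by_contra! h
    exact hdet (Polynomial.funext fun t => by simpa using h t)
  refine ⟨X + t • Y, ?_, fun A C hAC => ?_⟩
  · rw [Matrix.isUnit_iff_isUnit_det, isUnit_iff_ne_zero]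
    have := hQ t
    rw [coe_aeval_eq_eval] at this
    rw [this] at ht
    exact ht
  · have hre : A * X = X * C := by
      ext i j
      have := congrArg Complex.re (congrFun (congrFun hAC i) j)
      simpa [Matrix.mul_apply, X] using this
    have him : A * Y = Y * C := by
      ext i j
      have := congrArg Complex.im (congrFun (congrFun hAC i) j)
      simpa [Matrix.mul_apply, Y] using this
    rw [mul_add, add_mul, mul_smul_comm, smul_mul_assoc, hre, him]

end RealSimilarity

section Jordan

theorem isNilpotent_jordanBlock_sub (k : ℕ) (μ : ℂ) :
    IsNilpotent (jordanBlock k μ - algebraMap ℂ _ μ) := by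
  have h1 : (jordanBlock k μ).charpoly = (X - C μ) ^ k := by
    rw [Matrix.charpoly_of_isUpperTriangular]
    · simp [jordanBlock]
    · intro i j hij
      have h2 : j < i := hij
      have h3 : ¬ i = j := h2.ne'
      have h4 : ¬ i.val + 1 = j.val := by have := Fin.lt_def.1 h2; omega
      simp [jordanBlock, h3, h4]
  refine ⟨k, ?_⟩
  have h2 := Matrix.aeval_self_charpoly (jordanBlock k μ)
  rw [h1] at h2
  simpa using h2

theorem isNilpotent_aeval_sub {A : Type*} [Ring A] [Algebra ℂ A] {x : A} {μ : ℂ}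
    (hx : IsNilpotent (x - algebraMap ℂ A μ)) (p : ℂ[X]) :
    IsNilpotent (aeval x p - algebraMap ℂ A (p.eval μ)) := by
  obtain ⟨g, hg⟩ := Polynomial.X_sub_C_dvd_sub_C_eval (a := μ) (p := p)
  have h := congrArg (aeval x) hg
  simp only [map_sub, map_mul, aeval_X, aeval_C] at h
  rw [h]
  refine Commute.isNilpotent_mul_right ?_ hx
  have : Commute (aeval x (X - C μ)) (aeval x g) := by
    rw [Commute, SemiconjBy, ← map_mul, ← map_mul, mul_comm]
  simpa using this

theorem eq_zero_of_isNilpotent_of_mul_self {A : Type*} [Ring A] {a : A} (h : IsNilpotent a)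
    (ha : a * a = a) : a = 0 := by
  obtain ⟨k, hk⟩ := h
  have hi : IsIdempotentElem a := ha
  have := hi.pow_succ_eq k
  rw [pow_succ, hk, zero_mul] at this
  exact this.symm

-- On a single block `e(J) - e(μ)` is nilpotent with `e(μ)` equal to `0` or `1`, and an idempotent
-- differing from `0` or `1` by a nilpotent equals it.
open Classical in
theorem aeval_jordanBlock_projector {k : ℕ} (hk : 0 < k) {μ : ℂ} {f e : ℝ[X]}
    (hf : aeval (jordanBlock k μ) f = 0) (hdvd : f ∣ e * (1 - e))
    (he : ∀ z : ℂ, aeval z f = 0 →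
      (IsNegReal z → aeval z e = 1) ∧ (¬ IsNegReal z → aeval z e = 0)) :
    aeval (jordanBlock k μ) e = if IsNegReal μ then 1 else 0 := by
  have : Nonempty (Fin k) := ⟨⟨0, hk⟩⟩
  have hnil : ∀ p : ℝ[X], IsNilpotent (aeval (jordanBlock k μ) p -
      algebraMap ℂ (Matrix (Fin k) (Fin k) ℂ) (aeval μ p)) := fun p => by
    have := isNilpotent_aeval_sub (isNilpotent_jordanBlock_sub k μ) (p.map (algebraMap ℝ ℂ))
    rwa [aeval_map_algebraMap, eval_map_algebraMap] at this
  have hμ : aeval μ f = 0 := by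
    have h := hnil f
    rw [hf, zero_sub, isNilpotent_neg_iff] at h
    have h2 := (IsNilpotent.map_iff
      (FaithfulSMul.algebraMap_injective ℂ (Matrix (Fin k) (Fin k) ℂ))).1 h
    exact h2.eq_zero
  have hidem : aeval (jordanBlock k μ) e * aeval (jordanBlock k μ) e =
      aeval (jordanBlock k μ) e := by
    obtain ⟨g, hg⟩ := hdvd
    have h := congrArg (aeval (jordanBlock k μ)) hg
    rw [map_mul, map_mul, hf, zero_mul, map_sub, map_one, mul_sub, mul_one, sub_eq_zero] at h
    exact h.symm
  obtain ⟨h1, h2⟩ := he μ hμ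
  have hn := hnil e
  split_ifs with hneg
  · rw [h1 hneg, map_one] at hn
    have h3 : 1 - aeval (jordanBlock k μ) e = 0 := by
      refine eq_zero_of_isNilpotent_of_mul_self ?_ ?_
      · rw [← isNilpotent_neg_iff, neg_sub]; exact hn
      · rw [mul_sub, sub_mul, sub_mul, hidem]; simp
    exact (sub_eq_zero.1 h3).symm
  · rw [h2 hneg, map_zero, sub_zero] at hn
    exact eq_zero_of_isNilpotent_of_mul_self hn hidem

theorem aeval_blockDiagonal' {r : ℕ} {size : Fin r → ℕ}
    (D : ∀ i, Matrix (Fin (size i)) (Fin (size i)) ℂ) (p : ℝ[X]) :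
    aeval (Matrix.blockDiagonal' D) p = Matrix.blockDiagonal' fun i => aeval (D i) p := by
  induction p using Polynomial.induction_on' with
  | add p q hp hq =>
    rw [map_add, hp, hq, ← Matrix.blockDiagonal'_add]
    congr 1
    funext i
    simp
  | monomial k a =>
    simp only [aeval_monomial, ← Algebra.smul_def]
    rw [← Matrix.blockDiagonal'_pow, ← Matrix.blockDiagonal'_smul]
    rfl

/-- The real block matrix on `Σ i, Fin (size i)` with block entries `φ (ev i) a b`. -/
def blockMatrix {r : ℕ} (size : Fin r → ℕ) (ev : Fin r → ℂ) (φ : ℂ → ℕ → ℕ → ℝ) :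
    Matrix (Σ i, Fin (size i)) (Σ i, Fin (size i)) ℝ :=
  Matrix.of fun x y => if x.1 = y.1 then φ (ev x.1) x.2.val y.2.val else 0

theorem blockDiagonal'_eq_map_blockMatrix {r : ℕ} {size : Fin r → ℕ} {ev : Fin r → ℂ}
    {φ : ℂ → ℕ → ℕ → ℝ} {D : ∀ i, Matrix (Fin (size i)) (Fin (size i)) ℂ}
    (h : ∀ i a b, D i a b = φ (ev i) a.val b.val) :
    Matrix.blockDiagonal' D = (blockMatrix size ev φ).map Complex.ofReal := by
  ext ⟨i, a⟩ ⟨j, b⟩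
  by_cases hij : i = j
  · subst hij
    simp [blockMatrix, h]
  · simp [blockMatrix, Matrix.blockDiagonal'_apply_ne _ _ _ hij, hij]

open Classical in
/-- Entries of the projector onto the Jordan blocks with negative real eigenvalue. -/
def projectorEntry (z : ℂ) (a b : ℕ) : ℝ := if IsNegReal z ∧ a = b then 1 else 0

open Classical in
/-- Entries of the Jordan blocks with negative real eigenvalue. -/
def jordanEntry (z : ℂ) (a b : ℕ) : ℝ :=
  if IsNegReal z then (if a = b then z.re else if a + 1 = b then 1 else 0) else 0

/-- Pairing equal Jordan blocks gives a complex structure on the negative part. -/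
theorem exists_complexStructure_jordan {r : ℕ} (size : Fin r → ℕ) (ev : Fin r → ℂ)
    (heven : ∀ (k : ℕ) (μ : ℝ), μ < 0 → Even (Nat.card {i : Fin r // size i = k ∧ ev i = (μ : ℂ)})) :
    ∃ K : Matrix (Σ i, Fin (size i)) (Σ i, Fin (size i)) ℝ,
      K * K = -blockMatrix size ev projectorEntry ∧
      K * blockMatrix size ev projectorEntry = K ∧
      ∀ φ, Commute K (blockMatrix size ev φ) := by
  obtain ⟨σ, s, h1, h2, h3, h4, h5⟩ := exists_fiberwise_pairing (fun i => (size i, ev i))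
    (fun y => IsNegReal y.2) (by
      rintro ⟨k, z⟩ hz
      have hz' : (z.re : ℂ) = z := Complex.ext (by simp) (by simpa using hz.2.symm)
      have := heven k z.re hz.1
      rw [hz'] at this
      simpa [Prod.ext_iff] using this)
  simp only [Prod.mk.injEq] at h2
  -- Each index moves to the same position in the partner block. Partners share size and eigenvalue,
  -- so the signed swap commutes with every `blockMatrix`.
  let τ : (Σ i, Fin (size i)) → (Σ i, Fin (size i)) :=
    fun x => ⟨σ x.1, Fin.cast (h2 x.1).1.symm x.2⟩
  have hτ : ∀ x, τ (τ x) = x := by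
    rintro ⟨i, a⟩
    refine Sigma.ext (h1 i) ?_
    simp only [τ]
    rw [Fin.heq_ext_iff (by rw [h1])]
    simp
  have hswap : ∀ i j, σ i = j ↔ i = σ j := fun i j =>
    ⟨fun h => by rw [← h, h1], fun h => by rw [h, h1]⟩
  have hK : ∀ x, s (τ x).1 = -s x.1 := fun x => h3 x.1
  refine ⟨signedInvolution τ fun x => s x.1, ?_, ?_, fun φ => ?_⟩
  · rw [signedInvolution_mul_self hτ hK]
    congr 1
    ext ⟨i, a⟩ ⟨j, b⟩
    by_cases hij : i = j
    · subst hij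
      by_cases hneg : IsNegReal (ev i)
      · by_cases hab : a = b
        · simp [blockMatrix, projectorEntry, hab, hneg, h4 i hneg]
        · simp [blockMatrix, projectorEntry, hab, Fin.val_inj]
      · simp [blockMatrix, projectorEntry, hneg, h5 i hneg, Matrix.diagonal_apply]
    · simp [blockMatrix, hij]
  · ext ⟨i, a⟩ ⟨j, b⟩
    rw [signedInvolution_mul]
    by_cases hij : σ i = j
    · subst hij
      by_cases hneg : IsNegReal (ev i)
      · simp [blockMatrix, projectorEntry, signedInvolution, τ, (h2 i).2, hneg, Fin.ext_iff]
      · simp [signedInvolution, h5 i hneg]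
    · simp [blockMatrix, signedInvolution, τ, hij]
  · ext ⟨i, a⟩ ⟨j, b⟩
    rw [signedInvolution_mul, mul_signedInvolution hτ]
    by_cases hij : σ i = j
    · subst hij
      simp [blockMatrix, τ, h1, (h2 i).2]
    · have hij' : ¬ i = σ j := fun h => hij ((hswap i j).2 h)
      simp [blockMatrix, τ, hij, hij']

end Jordan

section ComplexStructure

variable {M : ℕ}

theorem exists_real_complexStructure {B : Matrix (Fin M) (Fin M) ℝ} {e : ℝ[X]}
    (hdvd : B.charpoly ∣ e * (1 - e))
    (he : ∀ z : ℂ, aeval z B.charpoly = 0 →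
      (IsNegReal z → aeval z e = 1) ∧ (¬ IsNegReal z → aeval z e = 0))
    (heven : EvenNegativeJordanBlocks (toComplex B)) :
    ∃ K : Matrix (Fin M) (Fin M) ℝ, Commute K B ∧ K * aeval B e = K ∧ K * K = -aeval B e := by
  classical
  obtain ⟨r, size, ev, ⟨hpos, e', P, hP, hBP⟩, hev⟩ := heven
  obtain ⟨K₀, hK1, hK2, hK3⟩ := exists_complexStructure_jordan size ev hev
  set J := Matrix.blockDiagonal' fun i => jordanBlock (size i) (ev i) with hJ
  let ρ := Matrix.reindexAlgEquiv ℝ ℂ e'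
  let ρr := Matrix.reindexAlgEquiv ℝ ℝ e'
  have hdetP := (Matrix.isUnit_iff_isUnit_det _).1 hP
  have hBP' : toComplex B * P = P * ρ J := by
    rw [hBP, mul_assoc, Matrix.nonsing_inv_mul _ hdetP, mul_one]
    rfl
  have hp : ∀ p : ℝ[X], toComplex (aeval B p) * P = P * ρ (aeval J p) := by
    intro p
    have h : SemiconjBy P (ρ J) (toComplex B) := hBP'.symm
    have h1 := semiconjBy_aeval h p
    rw [show aeval (ρ J) p = ρ (aeval J p) from
      aeval_algHom_apply (ρ : _ →ₐ[ℝ] Matrix (Fin M) (Fin M) ℂ) J p, aeval_toComplex] at h1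
    exact h1.symm
  have hf : ∀ i, aeval (jordanBlock (size i) (ev i)) B.charpoly = 0 := by
    have h := hp B.charpoly
    rw [Matrix.aeval_self_charpoly] at h
    have h0 : toComplex (0 : Matrix (Fin M) (Fin M) ℝ) = 0 := by rw [toComplex_eq, map_zero]
    rw [h0, zero_mul] at h
    have h1 := congrArg (P⁻¹ * ·) h
    simp only [mul_zero, ← mul_assoc, Matrix.nonsing_inv_mul _ hdetP, one_mul] at h1
    have h2 : aeval J B.charpoly = 0 := (map_eq_zero_iff ρ ρ.injective).1 h1.symm
    rw [hJ, aeval_blockDiagonal', ← Matrix.blockDiagonal'_zero] at h2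
    exact fun i => congrFun (Matrix.blockDiagonal'_injective h2) i
  have hE : aeval J e = (blockMatrix size ev projectorEntry).map Complex.ofReal := by
    rw [hJ, aeval_blockDiagonal']
    refine blockDiagonal'_eq_map_blockMatrix fun i a b => ?_
    rw [aeval_jordanBlock_projector (hpos i) (hf i) hdvd he]
    by_cases hneg : IsNegReal (ev i)
    · simp [projectorEntry, hneg, Matrix.one_apply, Fin.ext_iff, apply_ite]
    · simp [projectorEntry, hneg]
  -- Only `EB` is compared with Jordan form: the remaining blocks may be non-real, and descent to a
  -- real similarity needs real matrices.
  have hEJ : aeval J (e * X) = (blockMatrix size ev jordanEntry).map Complex.ofReal := by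
    rw [hJ, aeval_blockDiagonal']
    refine blockDiagonal'_eq_map_blockMatrix fun i a b => ?_
    rw [map_mul, aeval_X, aeval_jordanBlock_projector (hpos i) (hf i) hdvd he]
    by_cases hneg : IsNegReal (ev i)
    · have hz' : ((ev i).re : ℂ) = ev i := Complex.ext (by simp) (by simp [hneg.2])
      rw [if_pos hneg, one_mul, jordanEntry, if_pos hneg]
      by_cases hab : a = b
      · simp [jordanBlock, hab, hz']
      · have hab' : ¬ a.val = b.val := fun h => hab (Fin.ext h)
        by_cases hs : a.val + 1 = b.val <;> simp [jordanBlock, hab, hab', hs]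
    · simp [jordanEntry, hneg]
  obtain ⟨R, hR, hsim⟩ := exists_real_similarity P hP
  set E₀ := ρr (blockMatrix size ev projectorEntry) with hE₀
  set J₀ := ρr (blockMatrix size ev jordanEntry) with hJ₀
  have hER : aeval B e * R = R * E₀ := hsim _ _ (by
    have := hp e
    rw [hE] at this
    exact this)
  have hJR : (aeval B e * B) * R = R * J₀ := hsim _ _ (by
    have := hp (e * X)
    rw [hEJ, map_mul, aeval_X] at this
    exact this)
  have hdetR := (Matrix.isUnit_iff_isUnit_det _).1 hR
  have hRR : R⁻¹ * R = 1 := Matrix.nonsing_inv_mul _ hdetR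
  have hRR' : R * R⁻¹ = 1 := Matrix.mul_nonsing_inv _ hdetR
  have hEeq : aeval B e = R * E₀ * R⁻¹ := by rw [← hER, mul_assoc, hRR', mul_one]
  have hJeq : aeval B e * B = R * J₀ * R⁻¹ := by rw [← hJR, mul_assoc, hRR', mul_one]
  have hconj : ∀ U V : Matrix (Fin M) (Fin M) ℝ,
      R * U * R⁻¹ * (R * V * R⁻¹) = R * (U * V) * R⁻¹ := fun U V => by
    calc _ = R * U * (R⁻¹ * R) * V * R⁻¹ := by noncomm_ring
      _ = _ := by rw [hRR]; noncomm_ring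
  have hK1' : ρr K₀ * ρr K₀ = -E₀ := by rw [← map_mul, hK1, map_neg]
  have hK2' : ρr K₀ * E₀ = ρr K₀ := by rw [← map_mul, hK2]
  have hK3' : E₀ * ρr K₀ = ρr K₀ := by rw [← map_mul, ← (hK3 _).eq, hK2]
  have hK4' : ρr K₀ * J₀ = J₀ * ρr K₀ := by rw [← map_mul, (hK3 _).eq, map_mul]
  set K := R * ρr K₀ * R⁻¹ with hK
  have hKE : K * aeval B e = K := by rw [hEeq, hconj, hK2']
  have hEK : aeval B e * K = K := by rw [hEeq, hconj, hK3']
  have hBE : B * aeval B e = aeval B e * B := (commute_aeval (Commute.refl B) e).eq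
  refine ⟨K, ?_, hKE, ?_⟩
  -- As `KE = EK = K`, commuting with `EB` is enough.
  · calc K * B = K * (aeval B e * B) := by rw [← mul_assoc, hKE]
      _ = (aeval B e * B) * K := by rw [hJeq, hconj, hconj, hK4']
      _ = B * K := by rw [← hBE, mul_assoc, hEK]
  · rw [hconj, hK1', hEeq]
    noncomm_ring

end ComplexStructure

end JordanPairing

/-! ### Existence of the logarithm and its singularity. -/

section Equivalence

open Set Polynomial

attribute [local instance] Matrix.linftyOpNormedRing Matrix.linftyOpNormedAlgebra

variable {M : ℕ}

theorem exists_log_of_isUnit {B : Matrix (Fin M) (Fin M) ℝ} (hB : IsUnit B) :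
    ∃ L : Matrix (Fin M) (Fin M) ℂ, NormedSpace.exp L = toComplex B ∧
      (∀ μ ∈ spectrum ℂ L, |μ.im| ≤ Real.pi) ∧
      (EvenNegativeJordanBlocks (toComplex B) →
        ∃ R : Matrix (Fin M) (Fin M) ℝ, L = toComplex R) := by
  obtain ⟨e, hdvd, he⟩ := exists_projector_polynomial B.charpoly B.charpoly_monic.ne_zero
  -- One `L` must serve all the claims, so `K` is chosen real if the blocks pair up and `iE`
  -- otherwise.
  by_cases heven : EvenNegativeJordanBlocks (toComplex B)
  · obtain ⟨K, hKB, hKE, hKK⟩ := exists_real_complexStructure hdvd he heven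
    obtain ⟨h1, h2⟩ := exp_logIntegral_add (K := toComplex K) hB hdvd he
      (hKB.map (toComplexHom M)) (by rw [toComplex_eq, toComplex_eq, ← map_mul, hKE])
      (by rw [toComplex_eq, toComplex_eq, ← map_mul, hKK, map_neg])
    refine ⟨_, h1, h2, fun _ => ⟨logIntegral (reflect B e) + Real.pi • K, ?_⟩⟩
    simp only [toComplex_eq, map_add, map_smul]
  · have hEE : toComplex (aeval B e) * toComplex (aeval B e) = toComplex (aeval B e) := by
      rw [toComplex_eq, ← map_mul, aeval_mul_self_of_charpoly_dvd hdvd]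
    obtain ⟨h1, h2⟩ := exp_logIntegral_add (K := Complex.I • toComplex (aeval B e)) hB hdvd he
      (((commute_aeval (Commute.refl B) e).symm.map (toComplexHom M)).smul_left Complex.I)
      (by rw [smul_mul_assoc, hEE])
      (by rw [smul_mul_assoc, mul_smul_comm, hEE, smul_smul, Complex.I_mul_I, neg_smul, one_smul])
    exact ⟨_, h1, h2, fun h => absurd h heven⟩

theorem ne_two_pi_I_mul_of_abs_im_le {μ : ℂ} (hμ : |μ.im| ≤ Real.pi) {k : ℤ} (hk : k ≠ 0) :
    μ ≠ 2 * Real.pi * Complex.I * (k : ℂ) := by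
  rintro rfl
  have h1 : (2 * Real.pi * Complex.I * (k : ℂ)).im = 2 * Real.pi * k := by
    simp
  have h2 : (1 : ℝ) ≤ |(k : ℝ)| := by exact_mod_cast Int.one_le_abs hk
  rw [h1, abs_mul, abs_of_pos (by positivity)] at hμ
  nlinarith [Real.pi_pos]

/-- The nonzero space of fixed vectors of `B` is `L`-invariant. An eigenvalue of `L` on it satisfies
`exp μ = 1`, so it is `0`, the only multiple of `2πi` allowed. -/
theorem not_isUnit_of_exp_eq {B : Matrix (Fin M) (Fin M) ℝ} (hone : B.charpoly.eval 1 = 0)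
    {L : Matrix (Fin M) (Fin M) ℂ} (hL : IsLog (toComplex B) L) : ¬ IsUnit L := by
  have hdet : (1 - B).det = 0 := by
    rw [Matrix.eval_charpoly] at hone
    simpa using hone
  have hdet' : (1 - toComplex B).det = 0 := by
    have h1 : 1 - toComplex B = toComplex (1 - B) := by simp only [toComplex_eq, map_sub, map_one]
    rw [h1]
    have := (Complex.ofRealHom.map_det (1 - B)).symm
    rwa [hdet, map_zero] at this
  obtain ⟨v, hv0, hv⟩ := Matrix.exists_mulVec_eq_zero_iff.2 hdet'
  have hcomm : Commute L (toComplex B) := by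
    rw [← hL.1]
    exact commute_exp_of_commute (Commute.refl L)
  obtain ⟨w, hw, hw0, μ, hμ⟩ := exists_eigenvector_mem
    (LinearMap.ker (Matrix.mulVecLin (1 - toComplex B))) ⟨v, LinearMap.mem_ker.2 hv, hv0⟩ L
    (fun u hu => by
      simp only [LinearMap.mem_ker, Matrix.mulVecLin_apply] at hu ⊢
      rw [Matrix.mulVec_mulVec, ← ((Commute.one_right L).sub_right hcomm).eq,
        ← Matrix.mulVec_mulVec, hu, Matrix.mulVec_zero])
  rw [LinearMap.mem_ker, Matrix.mulVecLin_apply, Matrix.sub_mulVec, Matrix.one_mulVec,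
    sub_eq_zero, ← hL.1, exp_mulVec_eigenvector hμ] at hw
  have hexp : Complex.exp μ = 1 := by
    refine smul_left_injective ℂ hw0 ?_
    simp only [one_smul]
    exact hw.symm
  obtain ⟨k, hk⟩ := Complex.exp_eq_one_iff.1 hexp
  have hk0 : k = 0 := by
    by_contra hk0
    exact hL.2 μ (mem_spectrum_of_mulVec hw0 hμ) k hk0 (by rw [hk]; ring)
  rw [hk, hk0, Int.cast_zero, zero_mul, zero_smul] at hμ
  intro hU
  rw [Matrix.isUnit_iff_isUnit_det, isUnit_iff_ne_zero] at hU
  exact hU (Matrix.exists_mulVec_eq_zero_iff.1 ⟨w, hw0, hμ⟩)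

end Equivalence

end PLRNN

end

theorem theorem3 {M : ℕ} (a : Fin M → ℝ) (W : Matrix (Fin M) (Fin M) ℝ) (h : Fin M → ℝ)
    (Ω : Finset (Fin M)) (t₀ Δt : ℝ) (hΔt : 0 < Δt)
    (hinv : IsUnit (PLRNN.transitionMatrix a W Ω))
    (hone : (PLRNN.transitionMatrix a W Ω).charpoly.eval 1 = 0) :
    (∃ L : Matrix (Fin M) (Fin M) ℂ,
      PLRNN.IsLog (PLRNN.toComplex (PLRNN.transitionMatrix a W Ω)) L ∧
      (∀ μ ∈ spectrum ℂ L, |μ.im| ≤ Real.pi) ∧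
      (PLRNN.EvenNegativeJordanBlocks (PLRNN.toComplex (PLRNN.transitionMatrix a W Ω)) →
        ∃ R : Matrix (Fin M) (Fin M) ℝ, ((1 / Δt : ℝ) : ℂ) • L = PLRNN.toComplex R)) ∧
    ∀ L : Matrix (Fin M) (Fin M) ℂ,
      PLRNN.IsLog (PLRNN.toComplex (PLRNN.transitionMatrix a W Ω)) L →
      ¬ IsUnit (((1 / Δt : ℝ) : ℂ) • L) ∧
      IsUnit (PLRNN.toComplex (PLRNN.transitionMatrix a W Ω) * PLRNN.expIntegral L Δt) ∧
      PLRNN.IsEquivalentSystem (PLRNN.transitionMatrix a W Ω) h t₀ Δt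
        (((1 / Δt : ℝ) : ℂ) • L)
        ((PLRNN.toComplex (PLRNN.transitionMatrix a W Ω) * PLRNN.expIntegral L Δt)⁻¹ *ᵥ
          PLRNN.vecToComplex h) := by
  refine ⟨?_, fun L hL => ?_⟩
  · obtain ⟨L, h1, h2, h3⟩ := PLRNN.exists_log_of_isUnit hinv
    refine ⟨L, ⟨h1, fun μ hμ k hk => PLRNN.ne_two_pi_I_mul_of_abs_im_le (h2 μ hμ) hk⟩, h2,
      fun heven => ?_⟩
    obtain ⟨R, rfl⟩ := h3 heven
    refine ⟨(1 / Δt) • R, ?_⟩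
    rw [PLRNN.toComplex_eq, PLRNN.toComplex_eq, map_smul, Complex.coe_smul]
  · have hU : IsUnit (PLRNN.toComplex (PLRNN.transitionMatrix a W Ω) * PLRNN.expIntegral L Δt) :=
      (hinv.map (PLRNN.toComplexHom M)).mul (PLRNN.isUnit_expIntegral hΔt.ne' hL.2)
    refine ⟨fun h => PLRNN.not_isUnit_of_exp_eq hone hL ?_, hU,
      PLRNN.isEquivalentSystem_of_exp_eq hΔt hL.1 hU⟩
    have hΔ : ((1 / Δt : ℝ) : ℂ) ≠ 0 := by exact_mod_cast (one_div_pos.2 hΔt).ne'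
    exact (isUnit_smul_iff (Units.mk0 _ hΔ) L).1 h
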